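/- Fix finite-dimensional Hilbert spaces with fixed reference bases. A state is a positive semidefinite matrix of trace one. A real operation is a completely positive trace non-increasing linear map $\Lambda$ that has a Kraus representation $\Lambda(X)=\sum_j K_jXK_j^\dagger$ with finitely many Kraus operators $K_j$, all of whose matrix entries in the reference bases are real; the input and output dimensions may differ. The fidelity is $F(\rho,\sigma)=\big(\operatorname{tr}\sqrt{\sqrt\rho\,\sigma\sqrt\rho}\big)^2$. The geometric measure of imaginarity of a unit vector $|\psi\rangle$ is $\mathscr I_g(\psi)=1-\max_{\phi}|\langle\phi|\psi\rangle|^2$, the maximum being over unit vectors $|\phi\rangle$ with real entries, and that of a state $\rho$ is $\mathscr I_g(\rho)=\min\sum_j p_j\,\mathscr I_g(\psi_j)$, the minimum being over all finite pure state decompositions $\rho=\sum_j p_j|\psi_j\rangle\langle\psi_j|$. For a pure state $|\psi\rangle$, a state $\rho$ and $f\in[0,1]$, let $$P_f(\psi\to\rho)=\max_\Lambda\Big\{\operatorname{tr}\Lambda(|\psi\rangle\langle\psi|)\;:\;F\Big(\tfrac{\Lambda(|\psi\rangle\langle\psi|)}{\operatorname{tr}\Lambda(|\psi\rangle\langle\psi|)},\rho\Big)\ge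 f\Big\},$$ where $\Lambda$ runs over real operations with $\operatorname{tr}\Lambda(|\psi\rangle\langle\psi|)>0$, and $P_f=0$ if no such operation satisfies the constraint. For $p\in(0,1]$, let $$F_p(\psi\to\rho)=\max_\Lambda\Big\{F\Big(\tfrac{\Lambda(|\psi\rangle\langle\psi|)}{\operatorname{tr}\Lambda(|\psi\rangle\langle\psi|)},\rho\Big)\;:\;\operatorname{tr}\Lambda(|\psi\rangle\langle\psi|)\ge p\Big\},$$ where $\Lambda$ runs over real operations. Theorem. Let $|\psi\rangle$ be a pure state and $\rho$ an arbitrary state. The maxima defining $F_p$ for $p\in(0,1]$ are attained, and so are those defining $P_f$ for $f\in[0,1]$ whenever the constraint is satisfiable. For $f\in[0,1]$, put $m_1=\sin^{-1}\sqrt{\mathscr I_g(\psi)}-\sin^{-1}\sqrt{\mathscr I_g(\rho)}+\cos^{-1}\sqrt f$. Then $$P_f(\psi\to\rho)=\begin{cases}1 & \text{if } m_1\ge 0,\\[2pt] \dfrac{\mathscr I_g(\psi)}{\sin^2\!\big(\sin^{-1}\sqrt{\mathscr I_g(\rho)}-\cos^{-1}\sqrt f\big)} & \text{otherwise.}\end{cases}$$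 For $p\in(0,1]$, $$F_p(\psi\to\rho)=\begin{cases}1 & \text{if } p\,\mathscr I_g(\rho)\le \mathscr I_g(\psi),\\[2pt] \cos^2\!\Big[\sin^{-1}\sqrt{\mathscr I_g(\rho)}-\sin^{-1}\sqrt{\mathscr I_g(\psi)/p}\,\Big] & \text{otherwise.}\end{cases}$$ The condition $p\,\mathscr I_g(\rho)\le\mathscr I_g(\psi)$ says $p\le\mathscr I_g(\psi)/\mathscr I_g(\rho)$, the ratio being read as $+\infty$ when $\mathscr I_g(\rho)=0$. -/

import Mathlib

open scoped MatrixOrder ComplexOrder Matrix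

noncomputable section

namespace Imaginarity

/-- `v` is a unit vector of `ℂ^ι` (a pure state, in the reference basis indexed by `ι`). -/
def IsPureState {ι : Type*} [Fintype ι] (v : ι → ℂ) : Prop :=
  ∑ i, ‖v i‖ ^ 2 = 1

/-- The density matrix `|v⟩⟨v|`. -/
def ketbra {ι : Type*} (v : ι → ℂ) : Matrix ι ι ℂ :=
  Matrix.vecMulVec v (star v)

/-- A quantum state: a positive semidefinite matrix of trace one. -/
def IsDensityMatrix {ι : Type*} [Fintype ι] (ρ : Matrix ι ι ℂ) : Prop :=
  ρ.PosSemidef ∧ ρ.trace = 1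

/-- A (stochastic) real operation: a completely positive trace non-increasing map that has a
Kraus representation in which every Kraus operator has real matrix entries. -/
def IsRealOperation {ι κ : Type*} [Fintype ι] [Fintype κ]
    (Λ : Matrix ι ι ℂ →ₗ[ℂ] Matrix κ κ ℂ) : Prop :=
  (∃ (r : ℕ) (K : Fin r → Matrix κ ι ℂ),
    (∀ j a b, (K j a b).im = 0) ∧ ∀ X, Λ X = ∑ j, K j * X * (K j)ᴴ) ∧
  ∀ X : Matrix ι ι ℂ, X.PosSemidef → (Λ X).trace.re ≤ X.trace.re

/-- The Uhlmann fidelity `F(ρ, σ) = (tr √(√ρ σ √ρ))²`. -/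
def fidelity {ι : Type*} [Fintype ι] [DecidableEq ι] (ρ σ : Matrix ι ι ℂ) : ℝ :=
  (CFC.sqrt (CFC.sqrt ρ * σ * CFC.sqrt ρ)).trace.re ^ 2

/-- Geometric imaginarity of a pure state: `1 - max |⟨φ|v⟩|²` over real unit vectors `φ`. -/
def geomPure {ι : Type*} [Fintype ι] (v : ι → ℂ) : ℝ :=
  1 - sSup {x : ℝ | ∃ φ : ι → ℝ, ∑ i, φ i ^ 2 = 1 ∧ x = ‖∑ i, (φ i : ℂ) * v i‖ ^ 2}

/-- Geometric imaginarity of a state: the minimal average geometric imaginarity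
`∑ j, p j * I_g(v j)` over all pure state decompositions `ρ = ∑ j, p j |v j⟩⟨v j|`. -/
def geom {ι : Type*} [Fintype ι] (ρ : Matrix ι ι ℂ) : ℝ :=
  sInf {x : ℝ | ∃ (r : ℕ) (p : Fin r → ℝ) (v : Fin r → ι → ℂ),
    (∀ j, 0 ≤ p j) ∧ ∑ j, p j = 1 ∧ (∀ j, IsPureState (v j)) ∧
    ρ = ∑ j, (p j : ℂ) • ketbra (v j) ∧ x = ∑ j, p j * geomPure (v j)}

/-- The normalized output `X / tr X`. -/
def normalize {ι : Type*} [Fintype ι] (X : Matrix ι ι ℂ) : Matrix ι ι ℂ :=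
  X.trace⁻¹ • X

/-- The probabilities `tr Λ(ρ)` of the real operations `Λ` whose normalized output has fidelity at
least `f` with `σ`. A vanishing probability (no output at all) is always admitted. -/
def achievableProbabilities {ι κ : Type*} [Fintype ι] [Fintype κ] [DecidableEq κ]
    (ρ : Matrix ι ι ℂ) (σ : Matrix κ κ ℂ) (f : ℝ) : Set ℝ :=
  {p | ∃ Λ : Matrix ι ι ℂ →ₗ[ℂ] Matrix κ κ ℂ, IsRealOperation Λ ∧ p = (Λ ρ).trace.re ∧
    (p ≠ 0 → f ≤ fidelity (normalize (Λ ρ)) σ)}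

/-- `P_f(ρ → σ)`. -/
def optimalProbability {ι κ : Type*} [Fintype ι] [Fintype κ] [DecidableEq κ]
    (ρ : Matrix ι ι ℂ) (σ : Matrix κ κ ℂ) (f : ℝ) : ℝ :=
  sSup (achievableProbabilities ρ σ f)

/-- The fidelities with `σ` of the normalized outputs of the real operations that succeed on `ρ`
with probability at least `p` (used for `p > 0`). -/
def achievableFidelities {ι κ : Type*} [Fintype ι] [Fintype κ] [DecidableEq κ]
    (ρ : Matrix ι ι ℂ) (σ : Matrix κ κ ℂ) (p : ℝ) : Set ℝ :=
  {x | ∃ Λ : Matrix ι ι ℂ →ₗ[ℂ] Matrix κ κ ℂ, IsRealOperation Λ ∧ p ≤ (Λ ρ).trace.re ∧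
    x = fidelity (normalize (Λ ρ)) σ}

/-- `F_p(ρ → σ)`. -/
def optimalFidelity {ι κ : Type*} [Fintype ι] [Fintype κ] [DecidableEq κ]
    (ρ : Matrix ι ι ℂ) (σ : Matrix κ κ ℂ) (p : ℝ) : ℝ :=
  sSup (achievableFidelities ρ σ p)

/-- `m₁ = arcsin √I_g(ψ) - arcsin √I_g(ρ) + arccos √f`. -/
def m₁ {ι κ : Type*} [Fintype ι] [Fintype κ] (ψ : ι → ℂ) (ρ : Matrix κ κ ℂ) (f : ℝ) : ℝ :=
  Real.arcsin (√(geomPure ψ)) - Real.arcsin (√(geom ρ)) + Real.arccos (√f)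

end Imaginarity

end

/-!
Call a matrix `T` with `T * Tᴴ = ρ` a purification of `ρ` (its columns are the unnormalized vectors
of a pure state decomposition) and write `T = A + iB` with `A`, `B` real. After alignment of the
phases of the columns, `‖B‖²` is the average geometric imaginarity of the decomposition, so that
`geom ρ` is the minimum of `‖B‖²` over all purifications (`geom_le_imagWeight`,
`exists_optimal_purification`). The minimum exists since `‖B‖²` and `T * Tᴴ` depend only on the real
Gram matrix of the rows of `A` and `B`, so that `2 |κ|` columns suffice and the purifications form a
compact set; at a minimum with aligned phase, `A` and `B` are orthogonal.

Upper bounds. For a real operation with success probability `q` on `ψ`, the vectors `K j ψ` form a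
purification of the output, and trace non-increase on the imaginary part of `ψ` bounds its
imaginarity: `q * ‖B‖² ≤ geomPure ψ` (`exists_purification_of_normalized_output`). By Uhlmann's
theorem (`rootFidelity_attained`) the root fidelity of the normalized output with `ρ` is a real
inner product `⟨A, A'⟩ + ⟨B, B'⟩` with a purification `A' + iB'` of `ρ`, and Cauchy–Schwarz in each
summand bounds it by the cosine of the difference of the angles `arcsin ‖B'‖` and `arcsin ‖B‖`
(`rootFidelity_le_cos`).

Attainment. Conversely, `ψ` reaches `A + iB` with probability `q` as soon as `⟨A, B⟩ = 0`,
`q * ‖B‖² ≤ geomPure ψ` and `q * ‖A‖² ≤ 1 - geomPure ψ`: the Kraus operators send the real and the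
imaginary part of `ψ`, which are orthogonal, to multiples of the columns of `A` and `B`
(`exists_realOperation`). Rescaling the two parts of an optimal purification of `ρ` gives a target
for which Cauchy–Schwarz is an equality (`exists_realOperation_near`); if `ψ` is imaginary enough,
`ρ` itself is reached (`exists_realOperation_exact`).
-/

namespace Imaginarity

open Matrix

/-! ### Uhlmann's theorem -/

/-- Two matrices with the same left Gram matrix differ by a unitary acting on the columns. This also
serves as the polar decomposition below. The unitary extends the isometry `Aᴴ x ↦ Bᴴ x`. -/
theorem exists_unitary_of_mul_conjTranspose_eq {κ m : Type*} [Fintype κ] [Fintype m] [DecidableEq m]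
    (A B : Matrix κ m ℂ) (h : A * Aᴴ = B * Bᴴ) :
    ∃ U : Matrix m m ℂ, U * Uᴴ = 1 ∧ Uᴴ * U = 1 ∧ B = A * U := by
  classical
  set f := toEuclideanLin Aᴴ with hf
  set g := toEuclideanLin Bᴴ with hg
  have hcomp : f.adjoint ∘ₗ f = g.adjoint ∘ₗ g := by
    rw [hf, hg, ← toEuclideanLin_conjTranspose_eq_adjoint,
      ← toEuclideanLin_conjTranspose_eq_adjoint, conjTranspose_conjTranspose,
      conjTranspose_conjTranspose]
    ext x i
    have := congrFun (congrArg (fun M => M *ᵥ x.ofLp) h) i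
    simpa [toLpLin_apply] using this
  have hnorm : ∀ x, ‖f x‖ = ‖g x‖ := by
    intro x
    have h1 : inner ℂ (f x) (f x) = inner ℂ (g x) (g x) := by
      rw [← LinearMap.adjoint_inner_right, ← LinearMap.adjoint_inner_right]
      exact congrArg (fun y => inner ℂ x y) (LinearMap.congr_fun hcomp x)
    have h2 : ‖f x‖ ^ 2 = ‖g x‖ ^ 2 := by
      rw [← inner_self_eq_norm_sq (𝕜 := ℂ), ← inner_self_eq_norm_sq (𝕜 := ℂ), h1]
    exact (sq_eq_sq₀ (norm_nonneg _) (norm_nonneg _)).1 h2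
  obtain ⟨s, hs⟩ := f.rangeRestrict.exists_rightInverse_of_surjective f.range_rangeRestrict
  have hs' : ∀ y : LinearMap.range f, f (s y) = y := fun y =>
    congrArg Subtype.val (LinearMap.congr_fun hs y)
  let L : LinearMap.range f →ₗᵢ[ℂ] EuclideanSpace ℂ m :=
    ⟨g ∘ₗ s, fun y => by
      change ‖g (s y)‖ = ‖y‖
      rw [← hnorm, hs']; rfl⟩
  have hLf : ∀ x, L.extend (f x) = g x := by
    intro x
    have h1 := L.extend_apply ⟨f x, LinearMap.mem_range_self f x⟩
    rw [h1]
    change g (s _) = g x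
    rw [← sub_eq_zero, ← map_sub, ← norm_eq_zero, ← hnorm, map_sub, hs']
    simp
  set W := toEuclideanLin.symm L.extend.toLinearMap with hW
  have hW' : toEuclideanLin W = L.extend.toLinearMap := by rw [hW]; simp
  have h1 : W * Aᴴ = Bᴴ := by
    apply toEuclideanLin.injective
    ext x i
    have := congrArg (fun v : EuclideanSpace ℂ m => v i) (hLf x)
    have h2 : L.extend (f x)
        = toEuclideanLin W (f x) := by rw [hW']; rfl
    simp only [h2] at this
    simpa [toLpLin_apply, hf, hg] using this
  have h2 : Wᴴ * W = 1 := by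
    apply toEuclideanLin.injective
    have : L.extend.toLinearMap.adjoint ∘ₗ L.extend.toLinearMap = LinearMap.id := by
      apply LinearMap.ext; intro x
      refine ext_inner_left ℂ fun y => ?_
      simp
    rw [← hW', ← toEuclideanLin_conjTranspose_eq_adjoint] at this
    ext x i
    have := congrArg (fun v : EuclideanSpace ℂ m => v i)
      (LinearMap.congr_fun this x)
    simpa [toLpLin_apply] using this
  refine ⟨Wᴴ, by simpa using h2, by simpa using mul_eq_one_comm.1 h2, ?_⟩
  rw [← conjTranspose_conjTranspose B, ← h1]
  simp

/-- The real part of the Hilbert–Schmidt inner product is at most the mean of the squared norms. -/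
theorem re_trace_mul_conjTranspose_le {κ m : Type*} [Fintype κ] [Fintype m] (X Y : Matrix κ m ℂ) :
    (X * Yᴴ).trace.re ≤ ((X * Xᴴ).trace.re + (Y * Yᴴ).trace.re) / 2 := by
  have h := (posSemidef_self_mul_conjTranspose (X - Y)).trace_nonneg
  have h1 := (Complex.le_def.1 h).1
  have h2 : (Y * Xᴴ).trace.re = (X * Yᴴ).trace.re := by
    have : (Y * Xᴴ) = (X * Yᴴ)ᴴ := by simp
    rw [this, trace_conjTranspose]; simp
  rw [conjTranspose_sub, Matrix.sub_mul, Matrix.mul_sub, Matrix.mul_sub, trace_sub, trace_sub,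
    trace_sub] at h1
  simp only [Complex.zero_re, Complex.sub_re, h2] at h1
  linarith

theorem conjTranspose_sqrt {κ : Type*} [Fintype κ] [DecidableEq κ] (A : Matrix κ κ ℂ) :
    (CFC.sqrt A)ᴴ = CFC.sqrt A :=
  (nonneg_iff_posSemidef.1 (CFC.sqrt_nonneg A)).isHermitian

theorem posSemidef_sqrt_mul_sqrt {κ : Type*} [Fintype κ] [DecidableEq κ] {τ ρ : Matrix κ κ ℂ}
    (hρ : ρ.PosSemidef) : (CFC.sqrt τ * ρ * CFC.sqrt τ).PosSemidef := by
  have := hρ.mul_mul_conjTranspose_same (CFC.sqrt τ)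
  rwa [conjTranspose_sqrt] at this

theorem sqrt_mul_sqrt_of_posSemidef {κ : Type*} [Fintype κ] [DecidableEq κ] {ρ : Matrix κ κ ℂ}
    (hρ : ρ.PosSemidef) : CFC.sqrt ρ * CFC.sqrt ρ = ρ :=
  CFC.sqrt_mul_sqrt_self ρ hρ.nonneg

/-- The root fidelity `√F(τ, ρ) = tr √(√τ ρ √τ)`. -/
noncomputable def rootFidelity {κ : Type*} [Fintype κ] [DecidableEq κ] (τ ρ : Matrix κ κ ℂ) : ℝ :=
  (CFC.sqrt (CFC.sqrt τ * ρ * CFC.sqrt τ)).trace.re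

theorem rootFidelity_nonneg {κ : Type*} [Fintype κ] [DecidableEq κ] (τ ρ : Matrix κ κ ℂ) :
    0 ≤ rootFidelity τ ρ :=
  (Complex.le_def.1 (nonneg_iff_posSemidef.1 (CFC.sqrt_nonneg _)).trace_nonneg).1

/-- `T` with `n` additional zero columns. -/
def padCols {κ m : Type*} (n : Type*) (T : Matrix κ m ℂ) : Matrix κ (m ⊕ n) ℂ :=
  fromCols T 0

theorem padCols_mul_conjTranspose {κ m n : Type*} [Fintype m] [Fintype n] (T S : Matrix κ m ℂ) :
    padCols n T * (padCols n S)ᴴ = T * Sᴴ := by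
  simp [padCols, conjTranspose_fromCols_eq_fromRows_conjTranspose, fromCols_mul_fromRows]

theorem coisometry_mul_conjTranspose {κ m : Type*} [Fintype κ] [Fintype m] [DecidableEq κ] :
    (fromCols 0 1 : Matrix κ (m ⊕ κ) ℂ) * (fromCols 0 1 : Matrix κ (m ⊕ κ) ℂ)ᴴ = 1 := by
  simp [conjTranspose_fromCols_eq_fromRows_conjTranspose, fromCols_mul_fromRows]

/-- The attainment part of Uhlmann's theorem, relative to a given purification `T` of `τ`. Padding
by `κ` columns makes room for a purification `R` of `ρ` even if `T` has few columns. -/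
theorem rootFidelity_attained {κ m : Type*} [Fintype κ] [Fintype m] [DecidableEq κ]
    {τ ρ : Matrix κ κ ℂ} (hρ : ρ.PosSemidef) (T : Matrix κ m ℂ) (hT : T * Tᴴ = τ) :
    ∃ R : Matrix κ (m ⊕ κ) ℂ, R * Rᴴ = ρ ∧
      (R * (padCols κ T)ᴴ).trace.re = rootFidelity τ ρ := by
  classical
  have hτ : τ.PosSemidef := hT ▸ posSemidef_self_mul_conjTranspose T
  set D := CFC.sqrt τ
  set r := CFC.sqrt ρ
  set P := CFC.sqrt (D * ρ * D)
  have hDD : D * D = τ := sqrt_mul_sqrt_of_posSemidef hτ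
  have hrr : r * r = ρ := sqrt_mul_sqrt_of_posSemidef hρ
  have hPP : P * P = D * ρ * D := sqrt_mul_sqrt_of_posSemidef (posSemidef_sqrt_mul_sqrt hρ)
  have hDs : Dᴴ = D := conjTranspose_sqrt _
  have hrs : rᴴ = r := conjTranspose_sqrt _
  have hPs : Pᴴ = P := conjTranspose_sqrt _
  set E : Matrix κ (m ⊕ κ) ℂ := fromCols 0 1
  have hE : E * Eᴴ = 1 := coisometry_mul_conjTranspose
  have hX : ∀ X : Matrix κ κ ℂ, X * E * (X * E)ᴴ = X * Xᴴ := fun X => by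
    rw [conjTranspose_mul, Matrix.mul_assoc, ← Matrix.mul_assoc E, hE, Matrix.one_mul]
  -- `D * E`, with `E` a coisometry, is the standard purification of `τ`; `T` is a rotation of it
  obtain ⟨U, hU, hU', hTU⟩ := exists_unitary_of_mul_conjTranspose_eq (D * E) (padCols κ T) (by
    rw [padCols_mul_conjTranspose, hT, hX, hDs, hDD])
  -- polar decomposition
  obtain ⟨V, hV, hV', hPV⟩ := exists_unitary_of_mul_conjTranspose_eq (D * r * E) (P * E) (by
    rw [hX, hX, conjTranspose_mul, hDs, hrs, hPs, hPP, ← hrr]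
    simp only [Matrix.mul_assoc])
  refine ⟨r * E * V * U, ?_, ?_⟩
  · simp only [conjTranspose_mul, hrs]
    calc r * E * V * U * (Uᴴ * (Vᴴ * (Eᴴ * r)))
        = r * (E * (V * (U * Uᴴ) * Vᴴ) * Eᴴ) * r := by simp only [Matrix.mul_assoc]
      _ = ρ := by rw [hU, Matrix.mul_one, hV, Matrix.mul_one, hE, Matrix.mul_one, hrr]
  · rw [hTU, conjTranspose_mul, conjTranspose_mul, hDs]
    have : r * E * V * U * (Uᴴ * (Eᴴ * D)) = r * E * V * (U * Uᴴ) * Eᴴ * D := by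
      simp only [Matrix.mul_assoc]
    rw [this, hU, Matrix.mul_one, trace_mul_comm]
    have : D * (r * E * V * Eᴴ) = D * r * E * V * Eᴴ := by simp only [Matrix.mul_assoc]
    rw [this, ← hPV, Matrix.mul_assoc, hE, Matrix.mul_one]
    rfl

/-- The inequality in Uhlmann's theorem: the overlap of two purifications is at most the root
fidelity. -/
theorem re_trace_le_rootFidelity {κ m : Type*} [Fintype κ] [Fintype m] [DecidableEq κ]
    {τ ρ : Matrix κ κ ℂ} (T R : Matrix κ m ℂ) (hT : T * Tᴴ = τ) (hR : R * Rᴴ = ρ) :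
    (R * Tᴴ).trace.re ≤ rootFidelity τ ρ := by
  classical
  have hτ : τ.PosSemidef := hT ▸ posSemidef_self_mul_conjTranspose T
  have hρ : ρ.PosSemidef := hR ▸ posSemidef_self_mul_conjTranspose R
  set D := CFC.sqrt τ
  set P := CFC.sqrt (D * ρ * D)
  set Q := CFC.sqrt P
  have hDD : D * D = τ := sqrt_mul_sqrt_of_posSemidef hτ
  have hPP : P * P = D * ρ * D := sqrt_mul_sqrt_of_posSemidef (posSemidef_sqrt_mul_sqrt hρ)
  have hQQ : Q * Q = P :=
    sqrt_mul_sqrt_of_posSemidef (nonneg_iff_posSemidef.1 (CFC.sqrt_nonneg _))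
  have hDs : Dᴴ = D := conjTranspose_sqrt _
  have hPs : Pᴴ = P := conjTranspose_sqrt _
  have hQs : Qᴴ = Q := conjTranspose_sqrt _
  set E : Matrix κ (m ⊕ κ) ℂ := fromCols 0 1
  have hE : E * Eᴴ = 1 := coisometry_mul_conjTranspose
  have hX : ∀ X : Matrix κ κ ℂ, X * E * (X * E)ᴴ = X * Xᴴ := fun X => by
    rw [conjTranspose_mul, Matrix.mul_assoc, ← Matrix.mul_assoc E, hE, Matrix.one_mul]
  -- `D * E`, with `E` a coisometry, is the standard purification of `τ`; `T` is a rotation of it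
  obtain ⟨U, hU, hU', hTU⟩ := exists_unitary_of_mul_conjTranspose_eq (D * E) (padCols κ T) (by
    rw [padCols_mul_conjTranspose, hT, hX, hDs, hDD])
  -- polar decomposition
  obtain ⟨V, hV, hV', hPV⟩ := exists_unitary_of_mul_conjTranspose_eq (P * E)
    (D * (padCols κ R * Uᴴ)) (by
      simp only [conjTranspose_mul, conjTranspose_conjTranspose, hPs, hDs]
      calc P * E * (Eᴴ * P) = P * (E * Eᴴ) * P := by simp only [Matrix.mul_assoc]
        _ = D * (padCols κ R * (padCols κ R)ᴴ) * D := by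
          rw [hE, Matrix.mul_one, hPP, padCols_mul_conjTranspose, hR]
        _ = D * (padCols κ R * (Uᴴ * U) * (padCols κ R)ᴴ) * D := by rw [hU', Matrix.mul_one]
        _ = _ := by simp only [Matrix.mul_assoc])
  have h1 : (R * Tᴴ).trace = (Q * E * V * (Q * E)ᴴ).trace := by
    rw [← padCols_mul_conjTranspose (n := κ), hTU, conjTranspose_mul, conjTranspose_mul, hDs,
      ← Matrix.mul_assoc, ← Matrix.mul_assoc, trace_mul_comm, ← Matrix.mul_assoc, hPV, ← hQQ,
      conjTranspose_mul, hQs, ← Matrix.mul_assoc, trace_mul_comm _ Q]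
    simp only [Matrix.mul_assoc]
  have h2 : (Q * E * V) * (Q * E * V)ᴴ = P := by
    simp only [conjTranspose_mul, hQs]
    calc Q * E * V * (Vᴴ * (Eᴴ * Q)) = Q * (E * (V * Vᴴ) * Eᴴ) * Q := by
          simp only [Matrix.mul_assoc]
      _ = P := by rw [hV, Matrix.mul_one, hE, Matrix.mul_one, hQQ]
  have h3 : (Q * E) * (Q * E)ᴴ = P := by
    rw [hX, hQs, hQQ]
  have h4 := re_trace_mul_conjTranspose_le (Q * E * V) (Q * E)
  rw [← h1, h2, h3] at h4
  change _ ≤ P.trace.re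
  linarith

/-! ### Real and imaginary weights; geometric imaginarity of pure states -/

theorem norm_sq_eq_re_sq_add_im_sq (z : ℂ) : ‖z‖ ^ 2 = z.re ^ 2 + z.im ^ 2 := by
  rw [Complex.sq_norm, Complex.normSq_apply]; ring

theorem sum_re_sq_add_sum_im_sq {ι : Type*} [Fintype ι] (v : ι → ℂ) :
    ∑ i, (v i).re ^ 2 + ∑ i, (v i).im ^ 2 = ∑ i, ‖v i‖ ^ 2 := by
  simp only [norm_sq_eq_re_sq_add_im_sq, Finset.sum_add_distrib]

theorem sum_norm_phase_mul {ι : Type*} [Fintype ι] (v : ι → ℂ) {z : ℂ} (hz : ‖z‖ = 1) :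
    ∑ i, ‖z * v i‖ ^ 2 = ∑ i, ‖v i‖ ^ 2 := by
  simp [hz]

/-- The phase `z` is chosen such that `∑ i, (z * v i) ^ 2` is real and nonnegative: its imaginary
part is twice the inner product of the real and imaginary parts of `z • v`, and its real part is the
difference of their squared norms. -/
theorem exists_phase_aligned {ι : Type*} [Fintype ι] (v : ι → ℂ) :
    ∃ z : ℂ, ‖z‖ = 1 ∧ ∑ i, (z * v i).re * (z * v i).im = 0 ∧
      ∑ i, (z * v i).im ^ 2 ≤ ∑ i, (z * v i).re ^ 2 ∧
      ∑ i, (z * v i).im ^ 2 ≤ ∑ i, (v i).im ^ 2 := by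
  set s := ∑ i, v i ^ 2 with hs
  obtain ⟨w, hw, hws⟩ : ∃ w : ℂ, ‖w‖ = 1 ∧ w * s = ‖s‖ := by
    rcases eq_or_ne s 0 with h | h
    · exact ⟨1, by simp, by simp [h]⟩
    · have hn : (‖s‖ : ℂ) ≠ 0 := by simpa using h
      refine ⟨‖s‖ / s, by simp [h], ?_⟩
      field_simp
  obtain ⟨z, hzw⟩ := IsSquare.exists_sq w (Complex.isSquare w)
  have hz : ‖z‖ = 1 := by
    have : ‖z‖ ^ 2 = 1 := by rw [← norm_pow, ← hzw, hw]
    exact (pow_eq_one_iff_of_nonneg (norm_nonneg z) two_ne_zero).1 this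
  have hsum : ∑ i, (z * v i) ^ 2 = ‖s‖ := by
    rw [← hws, hzw, hs, Finset.mul_sum]
    exact Finset.sum_congr rfl fun i _ => by ring
  have hre : ∀ u : ι → ℂ, (∑ i, u i ^ 2).re = ∑ i, (u i).re ^ 2 - ∑ i, (u i).im ^ 2 := by
    intro u
    rw [Complex.re_sum, ← Finset.sum_sub_distrib]
    exact Finset.sum_congr rfl fun i _ => by rw [sq, Complex.mul_re]; ring
  have him : (∑ i, (z * v i) ^ 2).im = 2 * ∑ i, (z * v i).re * (z * v i).im := by
    rw [Complex.im_sum, Finset.mul_sum]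
    exact Finset.sum_congr rfl fun i _ => by rw [sq, Complex.mul_im]; ring
  have h1 := hre fun i => z * v i
  have h2 := hre v
  rw [hsum, Complex.ofReal_re] at h1
  rw [← hs] at h2
  rw [hsum, Complex.ofReal_im] at him
  have h3 := sum_re_sq_add_sum_im_sq fun i => z * v i
  have h4 := sum_re_sq_add_sum_im_sq v
  simp only [sum_norm_phase_mul v hz] at h3
  have h5 := Complex.re_le_norm s
  exact ⟨z, hz, by linarith, by linarith [norm_nonneg s], by linarith⟩

theorem norm_sq_sum_ofReal_mul {ι : Type*} [Fintype ι] (φ : ι → ℝ) (v : ι → ℂ) :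
    ‖∑ i, (φ i : ℂ) * v i‖ ^ 2 = (∑ i, φ i * (v i).re) ^ 2 + (∑ i, φ i * (v i).im) ^ 2 := by
  rw [norm_sq_eq_re_sq_add_im_sq, Complex.re_sum, Complex.im_sum]
  simp

theorem norm_sum_phase_mul {ι : Type*} [Fintype ι] (φ : ι → ℝ) (v : ι → ℂ) {z : ℂ}
    (hz : ‖z‖ = 1) : ‖∑ i, (φ i : ℂ) * (z * v i)‖ = ‖∑ i, (φ i : ℂ) * v i‖ := by
  have : ∑ i, (φ i : ℂ) * (z * v i) = z * ∑ i, (φ i : ℂ) * v i := by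
    rw [Finset.mul_sum]
    exact Finset.sum_congr rfl fun i _ => by ring
  rw [this, norm_mul, hz, one_mul]

/-- If the real and imaginary parts of `v` are orthogonal and the real part dominates, then no real
unit vector overlaps with `v` more than the normalized real part does. -/
theorem norm_sq_overlap_le {ι : Type*} [Fintype ι] (φ : ι → ℝ) (hφ : ∑ i, φ i ^ 2 = 1)
    (v : ι → ℂ) (horth : ∑ i, (v i).re * (v i).im = 0)
    (hle : ∑ i, (v i).im ^ 2 ≤ ∑ i, (v i).re ^ 2) :
    ‖∑ i, (φ i : ℂ) * v i‖ ^ 2 ≤ ∑ i, (v i).re ^ 2 := by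
  rw [norm_sq_sum_ofReal_mul]
  set s := ∑ i, φ i * (v i).re with hs
  set t := ∑ i, φ i * (v i).im with ht
  set X := ∑ i, (v i).re ^ 2 with hX
  set Y := ∑ i, (v i).im ^ 2 with hY
  have hcs := Finset.sum_mul_sq_le_sq_mul_sq Finset.univ φ fun i => s * (v i).re + t * (v i).im
  have h1 : ∑ i, φ i * (s * (v i).re + t * (v i).im) = s ^ 2 + t ^ 2 := by
    rw [sq, sq]
    nth_rw 2 [hs]
    nth_rw 2 [ht]
    rw [Finset.mul_sum, Finset.mul_sum, ← Finset.sum_add_distrib]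
    exact Finset.sum_congr rfl fun i _ => by ring
  have h2 : ∑ i, (s * (v i).re + t * (v i).im) ^ 2 = s ^ 2 * X + t ^ 2 * Y := by
    have : ∑ i, (s * (v i).re + t * (v i).im) ^ 2 =
        s ^ 2 * X + t ^ 2 * Y + 2 * s * t * ∑ i, (v i).re * (v i).im := by
      rw [hX, hY, Finset.mul_sum, Finset.mul_sum, Finset.mul_sum, ← Finset.sum_add_distrib,
        ← Finset.sum_add_distrib]
      exact Finset.sum_congr rfl fun i _ => by ring
    rw [this, horth]; ring
  simp only [h1, h2, hφ, one_mul] at hcs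
  have h3 : t ^ 2 * Y ≤ t ^ 2 * X := mul_le_mul_of_nonneg_left hle (sq_nonneg t)
  rcases (add_nonneg (sq_nonneg s) (sq_nonneg t)).eq_or_lt with h0 | h0
  · rw [← h0]; exact Finset.sum_nonneg fun i _ => sq_nonneg _
  · refine le_of_mul_le_mul_left ?_ h0
    nlinarith

theorem bddAbove_overlaps {ι : Type*} [Fintype ι] (v : ι → ℂ) :
    BddAbove {x : ℝ | ∃ φ : ι → ℝ, ∑ i, φ i ^ 2 = 1 ∧ x = ‖∑ i, (φ i : ℂ) * v i‖ ^ 2} := by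
  obtain ⟨z, hz, h1, h2, -⟩ := exists_phase_aligned v
  refine ⟨∑ i, (z * v i).re ^ 2, ?_⟩
  rintro _ ⟨φ, hφ, rfl⟩
  rw [← norm_sum_phase_mul φ v hz]
  exact norm_sq_overlap_le φ hφ (fun i => z * v i) h1 h2

theorem geomPure_le_sum_im_sq {ι : Type*} [Fintype ι] {v : ι → ℂ} (hv : IsPureState v) {z : ℂ}
    (hz : ‖z‖ = 1) : geomPure v ≤ ∑ i, (z * v i).im ^ 2 := by
  have h1 := sum_re_sq_add_sum_im_sq fun i => z * v i
  simp only [sum_norm_phase_mul v hz] at h1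
  rw [IsPureState] at hv
  set X := ∑ i, (z * v i).re ^ 2 with hX
  suffices X ≤ sSup {x : ℝ | ∃ φ : ι → ℝ, ∑ i, φ i ^ 2 = 1 ∧ x = ‖∑ i, (φ i : ℂ) * v i‖ ^ 2} by
    rw [geomPure]; linarith
  have hX0 : 0 ≤ X := Finset.sum_nonneg fun i _ => sq_nonneg _
  rcases hX0.eq_or_lt with h0 | h0
  · rw [← h0]
    apply Real.sSup_nonneg
    rintro _ ⟨φ, -, rfl⟩
    positivity
  -- the normalized real part of `z • v` has squared overlap at least `X` with `v`
  · have hφ : ∑ i, ((z * v i).re / √X) ^ 2 = 1 := by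
      simp only [div_pow, Real.sq_sqrt hX0, ← Finset.sum_div]
      rw [← hX, div_self h0.ne']
    refine le_csSup_of_le (bddAbove_overlaps v) ⟨_, hφ, rfl⟩ ?_
    rw [← norm_sum_phase_mul _ v hz, norm_sq_sum_ofReal_mul]
    have : ∑ i, (z * v i).re / √X * (z * v i).re = √X := by
      simp only [div_mul_eq_mul_div, ← Finset.sum_div, ← sq]
      rw [← hX, Real.div_sqrt]
    rw [this, Real.sq_sqrt hX0]
    linarith [sq_nonneg (∑ i, (z * v i).re / √X * (z * v i).im)]

theorem exists_phase_geomPure_eq {ι : Type*} [Fintype ι] {v : ι → ℂ} (hv : IsPureState v) :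
    ∃ z : ℂ, ‖z‖ = 1 ∧ ∑ i, (z * v i).re * (z * v i).im = 0 ∧
      ∑ i, (z * v i).im ^ 2 = geomPure v ∧ ∑ i, (z * v i).re ^ 2 = 1 - geomPure v ∧
      geomPure v ≤ 1 / 2 := by
  obtain ⟨z, hz, h1, h2, -⟩ := exists_phase_aligned v
  have h3 := geomPure_le_sum_im_sq hv hz
  have h4 := sum_re_sq_add_sum_im_sq fun i => z * v i
  simp only [sum_norm_phase_mul v hz] at h4
  rw [IsPureState] at hv
  have h5 : sSup {x : ℝ | ∃ φ : ι → ℝ, ∑ i, φ i ^ 2 = 1 ∧ x = ‖∑ i, (φ i : ℂ) * v i‖ ^ 2} ≤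
      ∑ i, (z * v i).re ^ 2 := by
    apply Real.sSup_le
    · rintro _ ⟨φ, hφ, rfl⟩
      rw [← norm_sum_phase_mul φ v hz]
      exact norm_sq_overlap_le φ hφ (fun i => z * v i) h1 h2
    · exact Finset.sum_nonneg fun i _ => sq_nonneg _
  have h6 : ∑ i, (z * v i).im ^ 2 = geomPure v := by
    refine le_antisymm ?_ h3
    rw [geomPure]; linarith
  exact ⟨z, hz, h1, h6, by linarith, by linarith⟩

theorem geomPure_nonneg {ι : Type*} [Fintype ι] {v : ι → ℂ} (hv : IsPureState v) :
    0 ≤ geomPure v := by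
  obtain ⟨z, -, -, h, -⟩ := exists_phase_geomPure_eq hv
  rw [← h]
  exact Finset.sum_nonneg fun i _ => sq_nonneg _

/-- The squared Frobenius norm of the real part of `T`. -/
def realWeight {κ m : Type*} [Fintype κ] [Fintype m] (T : Matrix κ m ℂ) : ℝ :=
  ∑ i, ∑ j, (T i j).re ^ 2

/-- The squared Frobenius norm of the imaginary part of `T`. -/
def imagWeight {κ m : Type*} [Fintype κ] [Fintype m] (T : Matrix κ m ℂ) : ℝ :=
  ∑ i, ∑ j, (T i j).im ^ 2

/-- The Frobenius inner product of the real and the imaginary part of `T`. -/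
def crossWeight {κ m : Type*} [Fintype κ] [Fintype m] (T : Matrix κ m ℂ) : ℝ :=
  ∑ i, ∑ j, (T i j).re * (T i j).im

theorem phase_smul_mul_conjTranspose {κ m : Type*} [Fintype m]
    (T : Matrix κ m ℂ) {z : ℂ} (hz : ‖z‖ = 1) :
    (z • T) * (z • T)ᴴ = T * Tᴴ := by
  rw [conjTranspose_smul, Matrix.smul_mul, Matrix.mul_smul, smul_smul]
  simp [Complex.mul_conj, Complex.normSq_eq_norm_sq, hz]

section Weights

variable {κ m : Type*} [Fintype κ] [Fintype m]

theorem realWeight_nonneg (T : Matrix κ m ℂ) : 0 ≤ realWeight T :=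
  Finset.sum_nonneg fun _ _ => Finset.sum_nonneg fun _ _ => sq_nonneg _

theorem imagWeight_nonneg (T : Matrix κ m ℂ) : 0 ≤ imagWeight T :=
  Finset.sum_nonneg fun _ _ => Finset.sum_nonneg fun _ _ => sq_nonneg _

theorem re_trace_mul_conjTranspose (T S : Matrix κ m ℂ) :
    (T * Sᴴ).trace.re = ∑ i, ∑ j, ((T i j).re * (S i j).re + (T i j).im * (S i j).im) := by
  simp [Matrix.trace, Matrix.mul_apply]

theorem realWeight_add_imagWeight (T : Matrix κ m ℂ) :
    realWeight T + imagWeight T = (T * Tᴴ).trace.re := by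
  rw [re_trace_mul_conjTranspose, realWeight, imagWeight, ← Finset.sum_add_distrib]
  refine Finset.sum_congr rfl fun i _ => ?_
  rw [← Finset.sum_add_distrib]
  exact Finset.sum_congr rfl fun j _ => by ring

theorem imagWeight_padCols {n : Type*} [Fintype n] (T : Matrix κ m ℂ) :
    imagWeight (padCols n T) = imagWeight T := by
  simp [imagWeight, padCols]

theorem exists_phase_aligned_matrix (T : Matrix κ m ℂ) :
    ∃ z : ℂ, ‖z‖ = 1 ∧ crossWeight (z • T) = 0 ∧ imagWeight (z • T) ≤ realWeight (z • T) ∧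
      imagWeight (z • T) ≤ imagWeight T := by
  obtain ⟨z, h⟩ := exists_phase_aligned fun x : κ × m => T x.1 x.2
  simp only [Fintype.sum_prod_type] at h
  exact ⟨z, h⟩

/-- The Cauchy–Schwarz inequality, for the real and the imaginary parts separately. -/
theorem re_trace_le_sqrt_weights (T R : Matrix κ m ℂ) :
    (R * Tᴴ).trace.re ≤
      √(realWeight R) * √(realWeight T) + √(imagWeight R) * √(imagWeight T) := by
  have hcs := fun f g : κ × m → ℝ => Real.sum_mul_le_sqrt_mul_sqrt Finset.univ f g
  have h1 := hcs (fun x => (R x.1 x.2).re) fun x => (T x.1 x.2).re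
  have h2 := hcs (fun x => (R x.1 x.2).im) fun x => (T x.1 x.2).im
  simp only [Fintype.sum_prod_type] at h1 h2
  rw [re_trace_mul_conjTranspose]
  simp only [Finset.sum_add_distrib]
  exact add_le_add h1 h2

end Weights

/-! ### Geometric imaginarity as a minimum over purifications -/

theorem exists_real_gram_factor {a m : Type*} [Fintype a] [Fintype m]
    (H : Matrix a m ℝ) : ∃ S : Matrix a a ℝ, S * Sᵀ = H * Hᵀ := by
  classical
  have h : (H * Hᵀ).PosSemidef := by
    simpa using posSemidef_self_mul_conjTranspose H
  refine ⟨CFC.sqrt (H * Hᵀ), ?_⟩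
  have h1 : (CFC.sqrt (H * Hᵀ))ᵀ = CFC.sqrt (H * Hᵀ) := by
    simpa using (nonneg_iff_posSemidef.1 (CFC.sqrt_nonneg (H * Hᵀ))).isHermitian.eq
  rw [h1]
  exact CFC.sqrt_mul_sqrt_self _ h.nonneg

/-- A purification can be compressed to `2 |κ|` columns: `T * Tᴴ` and the imaginary weight only
depend on the real Gram matrix of the rows of the real and imaginary parts of `T`. -/
theorem exists_compression {κ m : Type*} [Fintype κ] [Fintype m] (T : Matrix κ m ℂ) :
    ∃ S : Matrix κ (κ ⊕ κ) ℂ, S * Sᴴ = T * Tᴴ ∧ imagWeight S = imagWeight T := by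
  let H : Matrix (κ ⊕ κ) m ℝ := fromRows (T.map Complex.re) (T.map Complex.im)
  obtain ⟨S, hS⟩ := exists_real_gram_factor H
  have hG : ∀ x y, ∑ j, S x j * S y j = ∑ j, H x j * H y j := by
    intro x y
    have := congrFun (congrFun hS x) y
    simpa [Matrix.mul_apply] using this
  refine ⟨Matrix.of fun i j => ⟨S (Sum.inl i) j, S (Sum.inr i) j⟩, ?_, ?_⟩
  · ext i k
    apply Complex.ext
    · have h1 := hG (Sum.inl i) (Sum.inl k)
      have h2 := hG (Sum.inr i) (Sum.inr k)
      simp only [Matrix.mul_apply, Complex.re_sum, conjTranspose_apply, of_apply, Complex.mul_re,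
        Complex.star_def, Complex.conj_re, Complex.conj_im, Finset.sum_sub_distrib, mul_neg,
        Finset.sum_neg_distrib, h1, h2]
      simp [H]
    · have h1 := hG (Sum.inl i) (Sum.inr k)
      have h2 := hG (Sum.inr i) (Sum.inl k)
      simp only [Matrix.mul_apply, Complex.im_sum, conjTranspose_apply, of_apply, Complex.mul_im,
        Complex.star_def, Complex.conj_re, Complex.conj_im, Finset.sum_add_distrib, mul_neg,
        Finset.sum_neg_distrib, h1, h2]
      simp [H]
  · rw [imagWeight, imagWeight]
    refine Finset.sum_congr rfl fun i _ => ?_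
    have h1 := hG (Sum.inr i) (Sum.inr i)
    simp only [of_apply, sq, h1]
    simp [H]

theorem norm_sq_apply_le {κ m : Type*} [Fintype κ] [Fintype m] (T : Matrix κ m ℂ) (i : κ) (j : m) :
    ‖T i j‖ ^ 2 ≤ (T * Tᴴ).trace.re := by
  rw [re_trace_mul_conjTranspose, norm_sq_eq_re_sq_add_im_sq, sq, sq]
  have h0 : ∀ i j, 0 ≤ (T i j).re * (T i j).re + (T i j).im * (T i j).im := fun i j =>
    add_nonneg (mul_self_nonneg _) (mul_self_nonneg _)
  exact (Finset.single_le_sum (fun j _ => h0 i j) (Finset.mem_univ j)).trans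
    (Finset.single_le_sum (f := fun i => ∑ j, _) (fun i _ => Finset.sum_nonneg fun j _ => h0 i j)
      (Finset.mem_univ i))

theorem isCompact_purifications {κ m : Type*} [Fintype κ] [Fintype m] (ρ : Matrix κ κ ℂ) :
    IsCompact {T : Matrix κ m ℂ | T * Tᴴ = ρ} := by
  set c := √(ρ.trace.re)
  have hK : IsCompact (Set.univ.pi fun _ : κ => Set.univ.pi fun _ : m =>
      Metric.closedBall (0 : ℂ) c) :=
    isCompact_univ_pi fun _ => isCompact_univ_pi fun _ => isCompact_closedBall _ _
  refine hK.of_isClosed_subset (isClosed_eq (by fun_prop) (by fun_prop)) ?_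
  intro T hT i _ j _
  rw [mem_closedBall_zero_iff]
  exact Real.le_sqrt_of_sq_le ((norm_sq_apply_le T i j).trans_eq 
    (congrArg (fun M : Matrix κ κ ℂ => M.trace.re) hT))

/-- Every vector, zero included, is its norm times a unit vector. -/
theorem exists_pure_direction {κ : Type*} [Fintype κ] [Nonempty κ] (u : κ → ℂ) :
    ∃ v : κ → ℂ, IsPureState v ∧ ∀ i, u i = √(∑ i, ‖u i‖ ^ 2) * v i := by
  classical
  have h0 : 0 ≤ ∑ i, ‖u i‖ ^ 2 := by positivity
  rcases h0.eq_or_lt with h | h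
  · refine ⟨Pi.single (Classical.arbitrary κ) 1, ?_, fun i => ?_⟩
    · rw [IsPureState, Finset.sum_eq_single (Classical.arbitrary κ)]
      · simp
      · intro b _ hb; simp [hb]
      · simp
    · rw [← h]
      have := (Finset.sum_eq_zero_iff_of_nonneg (fun i _ => by positivity)).1 h.symm i
        (Finset.mem_univ i)
      simpa using this
  · have hs : (√(∑ i, ‖u i‖ ^ 2) : ℂ) ≠ 0 := by
      exact_mod_cast (Real.sqrt_pos.2 h).ne'
    refine ⟨fun i => u i / √(∑ i, ‖u i‖ ^ 2), ?_, fun i => ?_⟩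
    · rw [IsPureState]
      simp only [norm_div, Complex.norm_real, div_pow, ← Finset.sum_div, Real.norm_eq_abs, sq_abs,
        Real.sq_sqrt h0]
      exact div_self h.ne'
    · field_simp

/-- The average geometric imaginarities of the pure state decompositions of `ρ`. -/
def decompositionValues {κ : Type*} [Fintype κ] (ρ : Matrix κ κ ℂ) : Set ℝ :=
  {x : ℝ | ∃ (r : ℕ) (p : Fin r → ℝ) (v : Fin r → κ → ℂ),
    (∀ j, 0 ≤ p j) ∧ ∑ j, p j = 1 ∧ (∀ j, IsPureState (v j)) ∧
    ρ = ∑ j, (p j : ℂ) • ketbra (v j) ∧ x = ∑ j, p j * geomPure (v j)}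

theorem bddBelow_decompositionValues {κ : Type*} [Fintype κ] (ρ : Matrix κ κ ℂ) :
    BddBelow (decompositionValues ρ) := by
  refine ⟨0, ?_⟩
  rintro _ ⟨r, p, v, hp, -, hv, -, rfl⟩
  exact Finset.sum_nonneg fun j _ => mul_nonneg (hp j) (geomPure_nonneg (hv j))

/-- The columns of a purification, normalized, form a pure state decomposition. -/
theorem exists_decomposition_of_purification {κ m : Type*} [Fintype κ] [Fintype m]
    {ρ : Matrix κ κ ℂ} (hρ : ρ.trace = 1) (T : Matrix κ m ℂ) (hT : T * Tᴴ = ρ) :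
    ∃ x ∈ decompositionValues ρ, x ≤ imagWeight T := by
  have : Nonempty κ := by
    by_contra h
    rw [not_nonempty_iff] at h
    simp [Matrix.trace] at hρ
  let e := (Fintype.equivFin m).symm
  choose v hv huv using fun j => exists_pure_direction fun i => T i j
  let p : m → ℝ := fun j => ∑ i, ‖T i j‖ ^ 2
  have hp : ∀ j, 0 ≤ p j := fun j => by positivity
  have hsum : ∑ j, p j = 1 := by
    have h1 := realWeight_add_imagWeight T
    rw [hT, hρ, Complex.one_re] at h1
    rw [← h1, realWeight, imagWeight, ← Finset.sum_add_distrib, Finset.sum_comm]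
    refine Finset.sum_congr rfl fun i _ => ?_
    rw [← Finset.sum_add_distrib]
    exact Finset.sum_congr rfl fun j _ => norm_sq_eq_re_sq_add_im_sq _
  refine ⟨_, ⟨_, fun j => p (e j), fun j => v (e j), fun j => hp _, ?_, fun j => hv _, ?_, rfl⟩, ?_⟩
  · rw [← hsum]; exact e.sum_comp p
  · rw [e.sum_comp fun j => (p j : ℂ) • ketbra (v j), ← hT]
    ext i k
    rw [Matrix.mul_apply, Matrix.sum_apply]
    refine Finset.sum_congr rfl fun j _ => ?_
    have h2 : (p j : ℂ) = √(p j) * √(p j) := by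
      exact_mod_cast (Real.mul_self_sqrt (hp j)).symm
    rw [conjTranspose_apply, huv j i, huv j k, Matrix.smul_apply, ketbra, vecMulVec_apply, h2]
    simp [p]
    ring
  · rw [e.sum_comp fun j => p j * geomPure (v j), imagWeight, Finset.sum_comm]
    refine Finset.sum_le_sum fun j _ => ?_
    have h2 := geomPure_le_sum_im_sq (hv j) (z := 1) (by simp)
    calc p j * geomPure (v j) ≤ p j * ∑ i, (1 * v j i).im ^ 2 :=
          mul_le_mul_of_nonneg_left h2 (hp j)
      _ = ∑ i, (T i j).im ^ 2 := by
          rw [Finset.mul_sum]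
          refine Finset.sum_congr rfl fun i _ => ?_
          rw [huv j i, Complex.im_ofReal_mul, mul_pow, Real.sq_sqrt (hp j), one_mul]

/-- Weighting the phase-aligned vectors of a pure state decomposition gives a purification whose
imaginary weight is the average geometric imaginarity. -/
theorem exists_purification_of_decomposition {κ : Type*} [Fintype κ]
    {ρ : Matrix κ κ ℂ} {x : ℝ} (hx : x ∈ decompositionValues ρ) :
    ∃ T : Matrix κ (κ ⊕ κ) ℂ, T * Tᴴ = ρ ∧ imagWeight T = x := by
  obtain ⟨r, p, v, hp, -, hv, rfl, rfl⟩ := hx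
  choose z hz _ him using fun j => exists_phase_geomPure_eq (hv j)
  let T : Matrix κ (Fin r) ℂ := Matrix.of fun i j => (√(p j) : ℂ) * (z j * v j i)
  obtain ⟨S, hS, hSi⟩ := exists_compression T
  refine ⟨S, hS.trans ?_, hSi.trans ?_⟩
  · ext i k
    rw [Matrix.mul_apply, Matrix.sum_apply]
    refine Finset.sum_congr rfl fun j _ => ?_
    have h2 : (p j : ℂ) = √(p j) * √(p j) := by
      exact_mod_cast (Real.mul_self_sqrt (hp j)).symm
    have h3 : z j * star (z j) = 1 := by
      simp [Complex.mul_conj, Complex.normSq_eq_norm_sq, hz]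
    rw [conjTranspose_apply, Matrix.smul_apply, ketbra, vecMulVec_apply, h2]
    simp only [T, of_apply, star_mul', smul_eq_mul, Pi.star_apply]
    rw [Complex.star_def, Complex.conj_ofReal]
    simp only [Complex.star_def] at h3 ⊢
    linear_combination (√(p j) : ℂ) * √(p j) * v j i * (starRingEnd ℂ) (v j k) * h3
  · rw [imagWeight, Finset.sum_comm]
    refine Finset.sum_congr rfl fun j _ => ?_
    rw [← (him j).1, Finset.mul_sum]
    refine Finset.sum_congr rfl fun i _ => ?_
    simp only [T, of_apply]
    rw [Complex.im_ofReal_mul, mul_pow, Real.sq_sqrt (hp j)]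

theorem geom_le_imagWeight {κ m : Type*} [Fintype κ] [Fintype m]
    {ρ : Matrix κ κ ℂ} (hρ : ρ.trace = 1) (T : Matrix κ m ℂ) (hT : T * Tᴴ = ρ) :
    geom ρ ≤ imagWeight T := by
  obtain ⟨x, hx, hxT⟩ := exists_decomposition_of_purification hρ T hT
  exact (csInf_le (bddBelow_decompositionValues ρ) hx).trans hxT

theorem exists_optimal_purification {κ : Type*} [Fintype κ] [DecidableEq κ] {ρ : Matrix κ κ ℂ}
    (hρ : IsDensityMatrix ρ) :
    ∃ T : Matrix κ (κ ⊕ κ) ℂ, T * Tᴴ = ρ ∧ crossWeight T = 0 ∧ imagWeight T = geom ρ ∧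
      realWeight T = 1 - geom ρ ∧ geom ρ ≤ 1 / 2 := by
  have hne : {T : Matrix κ (κ ⊕ κ) ℂ | T * Tᴴ = ρ}.Nonempty := by
    refine ⟨padCols κ (CFC.sqrt ρ), ?_⟩
    rw [Set.mem_ofPred_eq, padCols_mul_conjTranspose, conjTranspose_sqrt,
      sqrt_mul_sqrt_of_posSemidef hρ.1]
  have hcont : Continuous fun T : Matrix κ (κ ⊕ κ) ℂ => imagWeight T := by
    unfold imagWeight
    fun_prop
  obtain ⟨T₀, hT₀, hmin⟩ := (isCompact_purifications ρ).exists_isMinOn hne hcont.continuousOn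
  obtain ⟨z, hz, hcross, hle, hzT⟩ := exists_phase_aligned_matrix T₀
  have hzρ : (z • T₀) * (z • T₀)ᴴ = ρ := (phase_smul_mul_conjTranspose T₀ hz).trans hT₀
  have hsum := realWeight_add_imagWeight (z • T₀)
  rw [hzρ, hρ.2, Complex.one_re] at hsum
  have heq : imagWeight (z • T₀) = geom ρ := by
    refine le_antisymm (hzT.trans ?_) (geom_le_imagWeight hρ.2 _ hzρ)
    obtain ⟨x, hx, -⟩ := exists_decomposition_of_purification hρ.2 T₀ hT₀
    refine le_csInf (s := decompositionValues ρ) ⟨x, hx⟩ fun y hy => ?_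
    obtain ⟨S, hS, rfl⟩ := exists_purification_of_decomposition hy
    exact hmin hS
  exact ⟨z • T₀, hzρ, hcross, heq, by linarith, by linarith⟩

/-! ### Real operations on a pure state -/

theorem mul_ketbra_mul_conjTranspose {ι κ : Type*} [Fintype ι] (K : Matrix κ ι ℂ) (w : ι → ℂ) :
    K * ketbra w * Kᴴ = ketbra (K *ᵥ w) := by
  rw [ketbra, ketbra, mul_vecMulVec, vecMulVec_mul, star_mulVec]

theorem ketbra_phase_mul {ι : Type*} (v : ι → ℂ) {z : ℂ} (hz : ‖z‖ = 1) :
    ketbra (fun i => z * v i) = ketbra v := by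
  have h3 : z * (starRingEnd ℂ) z = 1 := by
    simp [Complex.mul_conj, Complex.normSq_eq_norm_sq, hz]
  ext i k
  simp only [ketbra, vecMulVec_apply, Pi.star_apply, star_mul', Complex.star_def]
  linear_combination v i * (starRingEnd ℂ) (v k) * h3

theorem trace_ketbra {ι : Type*} [Fintype ι] (v : ι → ℂ) :
    (ketbra v).trace = ((∑ i, ‖v i‖ ^ 2 : ℝ) : ℂ) := by
  simp [ketbra, Matrix.trace, vecMulVec_apply, Complex.mul_conj, Complex.normSq_eq_norm_sq]

theorem posSemidef_ketbra {ι : Type*} [Fintype ι] (v : ι → ℂ) : (ketbra v).PosSemidef :=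
  posSemidef_vecMulVec_self_star v

theorem mul_conjTranspose_eq_sum_ketbra {κ m : Type*} [Fintype m] (T : Matrix κ m ℂ) :
    T * Tᴴ = ∑ j, ketbra fun i => T i j := by
  ext i k
  simp [Matrix.mul_apply, Matrix.sum_apply, ketbra, vecMulVec_apply]

/-- Real operations do not increase the geometric imaginarity on average: the vectors `K_j ψ`
decompose the output, and, once the phase of `ψ` is aligned, their imaginary parts are the images
under the `K_j` of the imaginary part of `ψ`. -/
theorem exists_purification_of_realOperation {ι κ : Type*} [Fintype ι] [Fintype κ]
    {Λ : Matrix ι ι ℂ →ₗ[ℂ] Matrix κ κ ℂ} (hΛ : IsRealOperation Λ) {ψ : ι → ℂ}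
    (hψ : IsPureState ψ) :
    ∃ (r : ℕ) (T : Matrix κ (Fin r) ℂ), T * Tᴴ = Λ (ketbra ψ) ∧ imagWeight T ≤ geomPure ψ := by
  obtain ⟨⟨r, K, hK, hΛK⟩, htr⟩ := hΛ
  obtain ⟨z, hz, -, him, -⟩ := exists_phase_geomPure_eq hψ
  let y : ι → ℂ := fun i => ((z * ψ i).im : ℂ)
  refine ⟨r, Matrix.of fun k j => (K j *ᵥ fun i => z * ψ i) k, ?_, ?_⟩
  · rw [mul_conjTranspose_eq_sum_ketbra, hΛK, ← ketbra_phase_mul ψ hz]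
    exact Finset.sum_congr rfl fun j _ => (mul_ketbra_mul_conjTranspose _ _).symm
  · have h1 := htr _ (posSemidef_ketbra y)
    rw [hΛK, trace_ketbra, trace_sum, Complex.re_sum, Complex.ofReal_re] at h1
    simp only [mul_ketbra_mul_conjTranspose, trace_ketbra, Complex.ofReal_re] at h1
    have h2 : ∑ i, ‖y i‖ ^ 2 = geomPure ψ := by
      rw [← him]
      exact Finset.sum_congr rfl fun i _ => by
        simp only [y, Complex.norm_real, Real.norm_eq_abs, sq_abs]
    rw [h2] at h1
    refine le_trans (le_of_eq ?_) h1
    rw [imagWeight, Finset.sum_comm]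
    refine Finset.sum_congr rfl fun j _ => Finset.sum_congr rfl fun k _ => ?_
    have h3 : (K j *ᵥ y) k = (((K j *ᵥ fun i => z * ψ i) k).im : ℂ) := by
      simp only [mulVec, dotProduct, Complex.im_sum, Complex.ofReal_sum]
      refine Finset.sum_congr rfl fun i _ => ?_
      apply Complex.ext <;> simp [y, hK]
    rw [h3]
    simp

theorem trace_realOperation_le_one {ι κ : Type*} [Fintype ι] [Fintype κ]
    {Λ : Matrix ι ι ℂ →ₗ[ℂ] Matrix κ κ ℂ}
    (hΛ : IsRealOperation Λ) {ψ : ι → ℂ} (hψ : IsPureState ψ) :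
    (Λ (ketbra ψ)).trace.re ≤ 1 := by
  have h := hΛ.2 _ (posSemidef_ketbra ψ)
  rw [IsPureState] at hψ
  rwa [trace_ketbra, hψ, Complex.ofReal_re] at h

/-- The normalized output of a real operation, and the trade-off between its imaginarity and the
success probability. -/
theorem exists_purification_of_normalized_output {ι κ : Type*} [Fintype ι] [Fintype κ]
    {Λ : Matrix ι ι ℂ →ₗ[ℂ] Matrix κ κ ℂ} (hΛ : IsRealOperation Λ) {ψ : ι → ℂ}
    (hψ : IsPureState ψ) (hq : 0 < (Λ (ketbra ψ)).trace.re) :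
    ∃ (r : ℕ) (T : Matrix κ (Fin r) ℂ), T * Tᴴ = normalize (Λ (ketbra ψ)) ∧
      realWeight T + imagWeight T = 1 ∧
      (Λ (ketbra ψ)).trace.re * imagWeight T ≤ geomPure ψ := by
  obtain ⟨r, T, hT, hTi⟩ := exists_purification_of_realOperation hΛ hψ
  set Y := Λ (ketbra ψ)
  set q := Y.trace.re with hqdef
  have htr : Y.trace = (q : ℂ) := by
    have h := (hT ▸ posSemidef_self_mul_conjTranspose T : Y.PosSemidef).trace_nonneg
    exact Complex.ext rfl (by simpa using (Complex.le_def.1 h).2.symm)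
  have hs : (1 / √q) ^ 2 = q⁻¹ := by rw [div_pow, Real.sq_sqrt hq.le]; simp
  have hN : (((1 / √q : ℝ) : ℂ) • T) * (((1 / √q : ℝ) : ℂ) • T)ᴴ = normalize Y := by
    rw [normalize, conjTranspose_smul, Matrix.smul_mul, Matrix.mul_smul, smul_smul, hT, htr,
      Complex.star_def, Complex.conj_ofReal, ← Complex.ofReal_mul, ← sq, hs, Complex.ofReal_inv]
  refine ⟨r, _, hN, ?_, ?_⟩
  · rw [realWeight_add_imagWeight, hN, normalize, trace_smul, smul_eq_mul, inv_mul_cancel₀]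
    · simp
    · rw [htr]; exact_mod_cast hq.ne'
  · refine le_trans (le_of_eq ?_) hTi
    simp only [imagWeight, Matrix.smul_apply, smul_eq_mul, Complex.im_ofReal_mul, mul_pow, hs,
      ← Finset.mul_sum]
    rw [mul_inv_cancel_left₀ hq.ne']

/-- The completely positive map with Kraus operators `K j`. -/
def krausMap {ι κ m : Type*} [Fintype ι] [Fintype m] (K : m → Matrix κ ι ℂ) :
    Matrix ι ι ℂ →ₗ[ℂ] Matrix κ κ ℂ where
  toFun X := ∑ j, K j * X * (K j)ᴴ
  map_add' X Y := by simp [Matrix.mul_add, Matrix.add_mul, Finset.sum_add_distrib]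
  map_smul' c X := by simp [Finset.smul_sum]

/-- For real Kraus operators, trace non-increase need only be tested on real vectors. -/
theorem isRealOperation_krausMap {ι κ m : Type*} [Fintype ι] [Fintype κ] [Fintype m]
    (K : m → Matrix κ ι ℝ)
    (hK : ∀ u : ι → ℝ, ∑ j, ∑ k, (K j *ᵥ u) k ^ 2 ≤ ∑ i, u i ^ 2) :
    IsRealOperation (krausMap fun j => (K j).map Complex.ofReal) := by
  classical
  let e := (Fintype.equivFin m).symm
  refine ⟨⟨_, fun j => (K (e j)).map Complex.ofReal, fun j a b => by simp, fun X => ?_⟩,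
    fun X hX => ?_⟩
  · exact (e.sum_comp fun j => (K j).map Complex.ofReal * X * ((K j).map Complex.ofReal)ᴴ).symm
  · set S := CFC.sqrt X with hS
    have hSX : S * Sᴴ = X := by rw [conjTranspose_sqrt, sqrt_mul_sqrt_of_posSemidef hX]
    have h1 : ∀ j, ((K j).map Complex.ofReal * X * ((K j).map Complex.ofReal)ᴴ).trace.re =
        ∑ l, ((∑ k, (K j *ᵥ fun i => (S i l).re) k ^ 2) +
          ∑ k, (K j *ᵥ fun i => (S i l).im) k ^ 2) := by
      intro j
      have : (K j).map Complex.ofReal * X * ((K j).map Complex.ofReal)ᴴ =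
          ((K j).map Complex.ofReal * S) * ((K j).map Complex.ofReal * S)ᴴ := by
        rw [conjTranspose_mul, ← hSX]
        simp only [Matrix.mul_assoc]
      rw [this, ← realWeight_add_imagWeight, Finset.sum_add_distrib, realWeight, imagWeight,
        Finset.sum_comm]
      congr 1
      · simp [Matrix.mul_apply, mulVec, dotProduct]
      · rw [Finset.sum_comm]
        simp [Matrix.mul_apply, mulVec, dotProduct]
    have h2 : X.trace.re = ∑ l, (∑ i, (S i l).re ^ 2 + ∑ i, (S i l).im ^ 2) := by
      rw [← hSX, ← realWeight_add_imagWeight, Finset.sum_add_distrib, realWeight, imagWeight,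
        Finset.sum_comm]
      congr 1
      rw [Finset.sum_comm]
    change (∑ j, (K j).map Complex.ofReal * X * ((K j).map Complex.ofReal)ᴴ).trace.re ≤ _
    rw [trace_sum, Complex.re_sum, h2]
    simp only [h1]
    rw [Finset.sum_comm]
    refine Finset.sum_le_sum fun l _ => ?_
    rw [Finset.sum_add_distrib]
    exact add_le_add (hK _) (hK _)

/-- Bessel's inequality for two orthogonal vectors. A zero vector contributes `0` by the convention
`a / 0 = 0`. -/
theorem bessel_two {ι : Type*} [Fintype ι] {x y : ι → ℝ} (h : ∑ i, x i * y i = 0) (u : ι → ℝ) :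
    (∑ i, x i * u i) ^ 2 / (∑ i, x i ^ 2) + (∑ i, y i * u i) ^ 2 / (∑ i, y i ^ 2) ≤
      ∑ i, u i ^ 2 := by
  set X := ∑ i, x i ^ 2 with hX
  set Y := ∑ i, y i ^ 2 with hY
  set s := ∑ i, x i * u i with hs
  set t := ∑ i, y i * u i with ht
  have h0 : 0 ≤ ∑ i, (u i - s / X * x i - t / Y * y i) ^ 2 :=
    Finset.sum_nonneg fun i _ => sq_nonneg _
  have h1 : ∀ a b : ℝ, ∑ i, (u i - a * x i - b * y i) ^ 2 =
      ∑ i, u i ^ 2 + a ^ 2 * X + b ^ 2 * Y - 2 * a * s - 2 * b * t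
        + 2 * a * b * ∑ i, x i * y i := by
    intro a b
    simp only [hX, hY, hs, ht, Finset.mul_sum, ← Finset.sum_add_distrib, ← Finset.sum_sub_distrib]
    exact Finset.sum_congr rfl fun i _ => by ring
  have h2 : ∀ a b : ℝ, (a / b) ^ 2 * b = a ^ 2 / b := by
    intro a b
    rcases eq_or_ne b 0 with rfl | hb
    · simp
    · field_simp
  rw [h1, h, h2, h2] at h0
  have h3 : ∀ a b : ℝ, 2 * (a / b) * a = 2 * (a ^ 2 / b) := fun a b => by ring
  rw [h3, h3] at h0
  linarith

/-- A pure state can be sent by a real operation to `T * Tᴴ` with probability `q` if the real and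
imaginary parts of `T`, scaled by `√q`, are orthogonal and no longer than those of the
phase-aligned `ψ`. -/
theorem exists_realOperation {ι κ m : Type*} [Fintype ι] [Fintype κ] [Fintype m]
    {ψ : ι → ℂ} (hψ : IsPureState ψ) (T : Matrix κ m ℂ) (hcross : crossWeight T = 0)
    {q : ℝ} (hq : 0 ≤ q) (him : q * imagWeight T ≤ geomPure ψ)
    (hre : q * realWeight T ≤ 1 - geomPure ψ) :
    ∃ Λ : Matrix ι ι ℂ →ₗ[ℂ] Matrix κ κ ℂ, IsRealOperation Λ ∧
      Λ (ketbra ψ) = (q : ℂ) • (T * Tᴴ) := by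
  obtain ⟨z, hz, hxy, hY, hX, hle⟩ := exists_phase_geomPure_eq hψ
  set x : ι → ℝ := fun i => (z * ψ i).re with hx
  set y : ι → ℝ := fun i => (z * ψ i).im with hy
  set Y := geomPure ψ with hYdef
  set X := 1 - Y with hXdef
  change ∑ i, x i * y i = 0 at hxy
  change ∑ i, y i ^ 2 = Y at hY
  change ∑ i, x i ^ 2 = X at hX
  have hY0 : 0 ≤ Y := geomPure_nonneg hψ
  have hX0 : 0 < X := by linarith
  -- `K j` maps `x` to `√q` times the real part of the `j`-th column of `T`, and `y` to `√q` times
  -- its imaginary part; for `y = 0` the second term vanishes by the convention `a / 0 = 0`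
  let K : m → Matrix κ ι ℝ := fun j => Matrix.of fun k i =>
    √q * ((T k j).re * x i / X + (T k j).im * y i / Y)
  have hKmul : ∀ (j : m) (u : ι → ℝ) (k : κ), (K j *ᵥ u) k =
      √q * ((T k j).re * ((∑ i, x i * u i) / X) + (T k j).im * ((∑ i, y i * u i) / Y)) := by
    intro j u k
    simp only [mulVec, dotProduct, K, of_apply, Finset.sum_div, Finset.mul_sum,
      ← Finset.sum_add_distrib]
    exact Finset.sum_congr rfl fun i _ => by ring
  refine ⟨_, isRealOperation_krausMap K fun u => ?_, ?_⟩
  · simp only [hKmul]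
    refine le_trans ?_ (bessel_two hxy u)
    rw [hX, hY]
    set s := ∑ i, x i * u i
    set t := ∑ i, y i * u i
    have h1 : ∑ j, ∑ k, (√q * ((T k j).re * (s / X) + (T k j).im * (t / Y))) ^ 2 =
        (s / X) ^ 2 * (q * realWeight T) + (t / Y) ^ 2 * (q * imagWeight T) +
          2 * q * (s / X) * (t / Y) * crossWeight T := by
      rw [Finset.sum_comm]
      simp only [realWeight, imagWeight, crossWeight, Finset.mul_sum, ← Finset.sum_add_distrib]
      refine Finset.sum_congr rfl fun k _ => Finset.sum_congr rfl fun j _ => ?_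
      rw [mul_pow, Real.sq_sqrt hq]
      ring
    have h2 : ∀ a b : ℝ, a ^ 2 / b = (a / b) ^ 2 * b := by
      intro a b
      rcases eq_or_ne b 0 with rfl | hb
      · simp
      · field_simp
    rw [h1, hcross, mul_zero, add_zero, h2 s, h2 t]
    exact add_le_add (mul_le_mul_of_nonneg_left hre (sq_nonneg _))
      (mul_le_mul_of_nonneg_left him (sq_nonneg _))
  · have hb : Y = 0 → ∀ k j, √q * (T k j).im = 0 := by
      intro h k j
      have h1 : q * imagWeight T = 0 :=
        le_antisymm (him.trans h.le) (mul_nonneg hq (imagWeight_nonneg T))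
      rcases mul_eq_zero.1 h1 with h2 | h2
      · simp [h2]
      · have h3 := (Finset.sum_eq_zero_iff_of_nonneg
          fun i _ => Finset.sum_nonneg fun j _ => sq_nonneg _).1 h2 k (Finset.mem_univ k)
        have h4 := (Finset.sum_eq_zero_iff_of_nonneg fun j _ => sq_nonneg _).1 h3 j
          (Finset.mem_univ j)
        simp [pow_eq_zero_iff two_ne_zero |>.1 h4]
    have hyx : ∑ i, y i * x i = 0 := by rw [← hxy]; exact Finset.sum_congr rfl fun i _ => by ring
    have hKx : ∀ j k, (K j *ᵥ x) k = √q * (T k j).re := by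
      intro j k
      rw [hKmul, hyx]
      simp only [← sq, hX, div_self hX0.ne']
      simp
    have hKy : ∀ j k, (K j *ᵥ y) k = √q * (T k j).im := by
      intro j k
      rw [hKmul, hxy]
      simp only [← sq, hY]
      rcases eq_or_ne Y 0 with h | h
      · rw [hb h, h]; simp
      · simp [div_self h]
    have hcol : ∀ j, (K j).map Complex.ofReal *ᵥ (fun i => z * ψ i) =
        fun k => ((√q : ℝ) : ℂ) * T k j := by
      intro j
      ext k
      apply Complex.ext
      · rw [Complex.re_ofReal_mul, ← hKx]
        simp only [mulVec, dotProduct, map_apply, Complex.re_sum, Complex.re_ofReal_mul, hx]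
      · rw [Complex.im_ofReal_mul, ← hKy]
        simp only [mulVec, dotProduct, map_apply, Complex.im_sum, Complex.im_ofReal_mul, hy]
    change ∑ j, (K j).map Complex.ofReal * ketbra ψ * ((K j).map Complex.ofReal)ᴴ = _
    rw [← ketbra_phase_mul ψ hz, mul_conjTranspose_eq_sum_ketbra, Finset.smul_sum]
    refine Finset.sum_congr rfl fun j _ => ?_
    rw [mul_ketbra_mul_conjTranspose, hcol]
    have h2 : (q : ℂ) = √q * √q := by exact_mod_cast (Real.mul_self_sqrt hq).symm
    ext k l
    rw [Matrix.smul_apply, h2]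
    simp only [ketbra, vecMulVec_apply, Pi.star_apply, star_mul', Complex.star_def,
      Complex.conj_ofReal, smul_eq_mul]
    ring

/-! ### Fidelity and imaginarity of nearby states -/

theorem fidelity_eq_rootFidelity_sq {κ : Type*} [Fintype κ] [DecidableEq κ] (τ ρ : Matrix κ κ ℂ) :
    fidelity τ ρ = rootFidelity τ ρ ^ 2 := rfl

theorem fidelity_self {κ : Type*} [Fintype κ] [DecidableEq κ] {ρ : Matrix κ κ ℂ}
    (hρ : IsDensityMatrix ρ) : fidelity ρ ρ = 1 := by
  have hs := sqrt_mul_sqrt_of_posSemidef hρ.1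
  have h : CFC.sqrt ρ * ρ * CFC.sqrt ρ = ρ * ρ := by
    nth_rw 2 [← hs]
    rw [← Matrix.mul_assoc, hs, Matrix.mul_assoc, hs]
  rw [fidelity, h, CFC.sqrt_mul_self ρ hρ.1.nonneg, hρ.2]
  simp

theorem cos_arcsin_sqrt {a : ℝ} (ha : 0 ≤ a) : Real.cos (Real.arcsin (√a)) = √(1 - a) := by
  rw [Real.cos_arcsin, Real.sq_sqrt ha]

theorem sin_arcsin_sqrt {a : ℝ} (ha : a ≤ 1) : Real.sin (Real.arcsin (√a)) = √a :=
  Real.sin_arcsin (by linarith [Real.sqrt_nonneg a]) (Real.sqrt_le_one.2 ha)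

theorem cos_sub_arcsin_sqrt {a b : ℝ} (ha : 0 ≤ a) (ha' : a ≤ 1) (hb : 0 ≤ b) (hb' : b ≤ 1) :
    Real.cos (Real.arcsin (√a) - Real.arcsin (√b)) = √(1 - a) * √(1 - b) + √a * √b := by
  rw [Real.cos_sub, cos_arcsin_sqrt ha, cos_arcsin_sqrt hb, sin_arcsin_sqrt ha',
    sin_arcsin_sqrt hb']

theorem arcsin_sqrt_mono {a b : ℝ} (h : a ≤ b) : Real.arcsin (√a) ≤ Real.arcsin (√b) :=
  Real.monotone_arcsin (Real.sqrt_le_sqrt h)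

theorem arcsin_sqrt_nonneg (a : ℝ) : 0 ≤ Real.arcsin (√a) :=
  Real.arcsin_nonneg.2 (Real.sqrt_nonneg a)

theorem geom_nonneg {κ : Type*} [Fintype κ] [DecidableEq κ] {ρ : Matrix κ κ ℂ}
    (hρ : IsDensityMatrix ρ) : 0 ≤ geom ρ := by
  obtain ⟨T, -, -, h, -⟩ := exists_optimal_purification hρ
  exact h ▸ imagWeight_nonneg T

theorem rootFidelity_le_one {κ m : Type*} [Fintype κ] [Fintype m] [DecidableEq κ]
    {τ ρ : Matrix κ κ ℂ} (hρ : IsDensityMatrix ρ) (T : Matrix κ m ℂ) (hT : T * Tᴴ = τ)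
    (hsum : realWeight T + imagWeight T = 1) : rootFidelity τ ρ ≤ 1 := by
  obtain ⟨R, hR, hRT⟩ := rootFidelity_attained hρ.1 T hT
  have h := re_trace_mul_conjTranspose_le R (padCols κ T)
  rw [hRT, hR, hρ.2, padCols_mul_conjTranspose, ← realWeight_add_imagWeight, hsum,
    Complex.one_re] at h
  linarith

/-- A state with imaginarity at most `a ≤ geom ρ` has Bures angle at least
`arcsin √(geom ρ) - arcsin √a` from `ρ`. -/
theorem rootFidelity_le_cos {κ m : Type*} [Fintype κ] [Fintype m] [DecidableEq κ]
    {τ ρ : Matrix κ κ ℂ} (hρ : IsDensityMatrix ρ) (T : Matrix κ m ℂ) (hT : T * Tᴴ = τ)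
    (hsum : realWeight T + imagWeight T = 1) {a : ℝ} (ha : imagWeight T ≤ a) (hag : a ≤ geom ρ) :
    rootFidelity τ ρ ≤ Real.cos (Real.arcsin (√(geom ρ)) - Real.arcsin (√a)) := by
  obtain ⟨R, hR, hRT⟩ := rootFidelity_attained hρ.1 T hT
  have hRsum := realWeight_add_imagWeight R
  rw [hR, hρ.2, Complex.one_re] at hRsum
  have hTsum := realWeight_add_imagWeight (padCols κ T)
  rw [padCols_mul_conjTranspose, ← realWeight_add_imagWeight, hsum, imagWeight_padCols] at hTsum
  have hgR := geom_le_imagWeight hρ.2 R hR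
  have h := re_trace_le_sqrt_weights (padCols κ T) R
  rw [hRT, imagWeight_padCols, eq_sub_of_add_eq hRsum, eq_sub_of_add_eq hTsum,
    ← cos_sub_arcsin_sqrt (imagWeight_nonneg R) (by linarith [realWeight_nonneg R])
      (imagWeight_nonneg T) (by linarith [realWeight_nonneg T])] at h
  refine h.trans (Real.cos_le_cos_of_nonneg_of_le_pi ?_ ?_ ?_)
  · linarith [arcsin_sqrt_mono hag]
  · linarith [Real.arcsin_le_pi_div_two (√(imagWeight R)), arcsin_sqrt_nonneg (imagWeight T),
      Real.pi_pos]
  · linarith [arcsin_sqrt_mono ha, arcsin_sqrt_mono hgR]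

theorem normalize_smul {κ : Type*} [Fintype κ] {τ : Matrix κ κ ℂ} (hτ : τ.trace = 1) {q : ℂ}
    (hq : q ≠ 0) : normalize (q • τ) = τ := by
  rw [normalize, trace_smul, hτ, smul_eq_mul, mul_one, smul_smul, inv_mul_cancel₀ hq, one_smul]

theorem trace_mul_conjTranspose_eq_one {κ m : Type*} [Fintype κ] [Fintype m] {T : Matrix κ m ℂ}
    (h : realWeight T + imagWeight T = 1) : (T * Tᴴ).trace = 1 := by
  have h1 := (posSemidef_self_mul_conjTranspose T).trace_nonneg
  exact Complex.ext (by rw [← realWeight_add_imagWeight, h, Complex.one_re])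
    (by simpa using (Complex.le_def.1 h1).2.symm)

/-- The real and the imaginary part of an optimal purification of `ρ` are rescaled so that the
imaginary weight becomes `a`. By the equality case of the Cauchy–Schwarz inequality, this is the
nearest state with this imaginarity. -/
theorem exists_realOperation_near {ι κ : Type*} [Fintype ι] [Fintype κ] [DecidableEq κ]
    {ψ : ι → ℂ} (hψ : IsPureState ψ) {ρ : Matrix κ κ ℂ} (hρ : IsDensityMatrix ρ) {q a : ℝ}
    (hq : 0 < q) (hq1 : q ≤ 1) (ha : 0 ≤ a) (hag : a ≤ geom ρ) (hg : 0 < geom ρ)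
    (hqa : q * a = geomPure ψ) :
    ∃ Λ : Matrix ι ι ℂ →ₗ[ℂ] Matrix κ κ ℂ, IsRealOperation Λ ∧ (Λ (ketbra ψ)).trace.re = q ∧
      Real.cos (Real.arcsin (√(geom ρ)) - Real.arcsin (√a)) ≤
        rootFidelity (normalize (Λ (ketbra ψ))) ρ := by
  obtain ⟨T, hT, hTc, hTi, hTr, hg2⟩ := exists_optimal_purification hρ
  set g := geom ρ
  have hg0 : 0 ≤ g := hg.le
  have hg1 : 0 < 1 - g := by linarith
  have ha1 : 0 ≤ 1 - a := by linarith
  set α := √(1 - a) / √(1 - g) with hα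
  set β := √a / √g with hβ
  let S : Matrix κ (κ ⊕ κ) ℂ := Matrix.of fun i j => ⟨α * (T i j).re, β * (T i j).im⟩
  have hSr : realWeight S = 1 - a := by
    have : realWeight S = α ^ 2 * realWeight T := by
      simp only [realWeight, S, of_apply, mul_pow, Finset.mul_sum]
    rw [this, hTr, hα, div_pow, Real.sq_sqrt ha1, Real.sq_sqrt hg1.le, div_mul_cancel₀ _ hg1.ne']
  have hSi : imagWeight S = a := by
    have : imagWeight S = β ^ 2 * imagWeight T := by
      simp only [imagWeight, S, of_apply, mul_pow, Finset.mul_sum]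
    rw [this, hTi, hβ, div_pow, Real.sq_sqrt ha, Real.sq_sqrt hg0, div_mul_cancel₀ _ hg.ne']
  have hSc : crossWeight S = 0 := by
    have : crossWeight S = α * β * crossWeight T := by
      simp only [crossWeight, S, of_apply, Finset.mul_sum]
      exact Finset.sum_congr rfl fun i _ => Finset.sum_congr rfl fun j _ => by ring
    rw [this, hTc, mul_zero]
  have hStr : (S * Sᴴ).trace = 1 := trace_mul_conjTranspose_eq_one (by rw [hSr, hSi]; ring)
  obtain ⟨Λ, hΛ, hΛψ⟩ := exists_realOperation hψ S hSc hq.le (by rw [hSi, hqa])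
    (by rw [hSr, mul_sub, hqa]; linarith)
  refine ⟨Λ, hΛ, by rw [hΛψ, trace_smul, hStr]; simp, ?_⟩
  rw [hΛψ, normalize_smul hStr (by exact_mod_cast hq.ne')]
  refine le_trans (le_of_eq ?_) (re_trace_le_rootFidelity S T rfl hT)
  have h1 : (T * Sᴴ).trace.re = α * realWeight T + β * imagWeight T := by
    simp only [re_trace_mul_conjTranspose, realWeight, imagWeight, S, of_apply, Finset.mul_sum,
      ← Finset.sum_add_distrib]
    exact Finset.sum_congr rfl fun i _ => Finset.sum_congr rfl fun j _ => by ring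
  have h2 : ∀ x y : ℝ, 0 < y → √x / √y * y = √y * √x := by
    intro x y hy
    have := Real.mul_self_sqrt hy.le
    have h3 := (Real.sqrt_pos.2 hy).ne'
    field_simp
    rw [sq, this]
  rw [h1, hTr, hTi, hα, hβ, h2 _ _ hg1, h2 _ _ hg, cos_sub_arcsin_sqrt hg0 (by linarith) ha
    (by linarith)]

/-- Splitting each column of an optimal purification into two halves with opposite phases raises
the imaginary weight to any value up to `1 / 2`, and keeps the real and imaginary parts
orthogonal. -/
theorem exists_purification_imagWeight_eq {κ : Type*} [Fintype κ] [DecidableEq κ]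
    {ρ : Matrix κ κ ℂ} (hρ : IsDensityMatrix ρ) {a : ℝ} (hga : geom ρ ≤ a) (ha : a ≤ 1 / 2) :
    ∃ T : Matrix κ ((κ ⊕ κ) ⊕ (κ ⊕ κ)) ℂ, T * Tᴴ = ρ ∧ crossWeight T = 0 ∧ imagWeight T = a ∧
      realWeight T = 1 - a := by
  obtain ⟨T, hT, hTc, hTi, hTr, hg2⟩ := exists_optimal_purification hρ
  set g := geom ρ
  obtain ⟨t, ht0, ht1, hta⟩ : ∃ t : ℝ, 0 ≤ t ∧ t ≤ 1 ∧ g + t * (1 - 2 * g) = a := by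
    rcases hg2.eq_or_lt with h | h
    · exact ⟨0, le_rfl, zero_le_one, by linarith⟩
    · have h' : 0 < 1 - 2 * g := by linarith
      refine ⟨(a - g) / (1 - 2 * g), div_nonneg (by linarith) h'.le, ?_, ?_⟩
      · rw [div_le_one h']; linarith
      · rw [div_mul_cancel₀ _ h'.ne']; ring
  set s := √t / √2 with hs
  set c := √(1 - t) / √2 with hc
  have hss : s ^ 2 = t / 2 := by rw [hs, div_pow, Real.sq_sqrt ht0, Real.sq_sqrt zero_le_two]
  have hcc : c ^ 2 = (1 - t) / 2 := by
    rw [hc, div_pow, Real.sq_sqrt (by linarith), Real.sq_sqrt zero_le_two]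
  let S : Matrix κ ((κ ⊕ κ) ⊕ (κ ⊕ κ)) ℂ := fromCols ((⟨c, s⟩ : ℂ) • T) ((⟨c, -s⟩ : ℂ) • T)
  have hS : S * Sᴴ = ρ := by
    have h1 : star (⟨c, s⟩ : ℂ) * (⟨c, s⟩ : ℂ) + star (⟨c, -s⟩ : ℂ) * (⟨c, -s⟩ : ℂ) = 1 := by
      apply Complex.ext
      · simp; linarith
      · simp; ring
    rw [← hT]
    simp only [S, conjTranspose_fromCols_eq_fromRows_conjTranspose, fromCols_mul_fromRows,
      conjTranspose_smul, Matrix.smul_mul, Matrix.mul_smul, smul_smul]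
    rw [← add_smul, h1, one_smul]
  have hSi : imagWeight S = a := by
    have : imagWeight S = 2 * c ^ 2 * imagWeight T + 2 * s ^ 2 * realWeight T := by
      simp only [imagWeight, realWeight, Fintype.sum_sum_type (α₁ := κ ⊕ κ) (α₂ := κ ⊕ κ),
        Finset.mul_sum, ← Finset.sum_add_distrib]
      refine Finset.sum_congr rfl fun i _ => ?_
      refine Finset.sum_congr rfl fun j _ => ?_
      simp [S]
      ring
    rw [this, hTi, hTr, hss, hcc, ← hta]; ring
  have hSc : crossWeight S = 0 := by
    have : crossWeight S = 2 * (c ^ 2 - s ^ 2) * crossWeight T := by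
      simp only [crossWeight, Fintype.sum_sum_type (α₁ := κ ⊕ κ) (α₂ := κ ⊕ κ), Finset.mul_sum]
      refine Finset.sum_congr rfl fun i _ => ?_
      rw [← Finset.sum_add_distrib]
      refine Finset.sum_congr rfl fun j _ => ?_
      simp [S]
      ring
    rw [this, hTc, mul_zero]
  have hsum := realWeight_add_imagWeight S
  rw [hS, hρ.2, Complex.one_re] at hsum
  exact ⟨S, hS, hSc, hSi, by linarith⟩

/-! ### Optimal fidelities and probabilities -/

section Optimality

variable {ι κ : Type*} [Fintype ι] [Fintype κ] [DecidableEq κ]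

/-- If `geom ρ ≤ geomPure ψ`, the transformation is deterministic, through a purification of `ρ`
that is exactly as imaginary as `ψ`; otherwise an optimal purification is reached with
probability `p`. -/
theorem exists_realOperation_exact {ψ : ι → ℂ} (hψ : IsPureState ψ) {ρ : Matrix κ κ ℂ}
    (hρ : IsDensityMatrix ρ) {p : ℝ} (hp : 0 < p) (hp1 : p ≤ 1)
    (hle : p * geom ρ ≤ geomPure ψ) :
    ∃ Λ : Matrix ι ι ℂ →ₗ[ℂ] Matrix κ κ ℂ, IsRealOperation Λ ∧ p ≤ (Λ (ketbra ψ)).trace.re ∧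
      normalize (Λ (ketbra ψ)) = ρ := by
  obtain ⟨-, -, -, -, -, hh2⟩ := exists_phase_geomPure_eq hψ
  obtain ⟨-, -, -, -, -, hg2⟩ := exists_optimal_purification hρ
  obtain ⟨q, a, hq, hpq, hga, ha2, him, hre⟩ : ∃ q a : ℝ, 0 < q ∧ p ≤ q ∧ geom ρ ≤ a ∧
      a ≤ 1 / 2 ∧ q * a ≤ geomPure ψ ∧ q * (1 - a) ≤ 1 - geomPure ψ := by
    rcases le_total (geom ρ) (geomPure ψ) with h | h
    · exact ⟨1, geomPure ψ, one_pos, hp1, h, hh2, by linarith, by linarith⟩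
    · refine ⟨p, geom ρ, hp, le_rfl, le_rfl, hg2, hle, ?_⟩
      nlinarith
  obtain ⟨T, hT, hTc, hTi, hTr⟩ := exists_purification_imagWeight_eq hρ hga ha2
  obtain ⟨Λ, hΛ, hΛψ⟩ := exists_realOperation hψ T hTc hq.le (by rwa [hTi]) (by rwa [hTr])
  rw [hT] at hΛψ
  refine ⟨Λ, hΛ, ?_, ?_⟩
  · rw [hΛψ, trace_smul, hρ.2]
    simpa using hpq
  · rw [hΛψ, normalize_smul hρ.2 (by exact_mod_cast hq.ne')]

theorem isGreatest_achievableFidelities_one {ψ : ι → ℂ} (hψ : IsPureState ψ) {ρ : Matrix κ κ ℂ}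
    (hρ : IsDensityMatrix ρ) {p : ℝ} (hp : 0 < p) (hp1 : p ≤ 1)
    (hle : p * geom ρ ≤ geomPure ψ) :
    IsGreatest (achievableFidelities (ketbra ψ) ρ p) 1 := by
  constructor
  · obtain ⟨Λ, hΛ, htr, hout⟩ := exists_realOperation_exact hψ hρ hp hp1 hle
    exact ⟨Λ, hΛ, htr, by rw [hout, fidelity_self hρ]⟩
  · rintro _ ⟨Λ, hΛ, htr, rfl⟩
    obtain ⟨r, T, hT, hsum, -⟩ :=
      exists_purification_of_normalized_output hΛ hψ (hp.trans_le htr)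
    rw [fidelity_eq_rootFidelity_sq]
    exact pow_le_one₀ (rootFidelity_nonneg _ _) (rootFidelity_le_one hρ T hT hsum)

theorem isGreatest_achievableFidelities_cos {ψ : ι → ℂ} (hψ : IsPureState ψ) {ρ : Matrix κ κ ℂ}
    (hρ : IsDensityMatrix ρ) {p : ℝ} (hp : 0 < p) (hp1 : p ≤ 1)
    (hlt : geomPure ψ < p * geom ρ) :
    IsGreatest (achievableFidelities (ketbra ψ) ρ p)
      (Real.cos (Real.arcsin (√(geom ρ)) - Real.arcsin (√(geomPure ψ / p))) ^ 2) := by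
  have hh0 := geomPure_nonneg hψ
  have hg0 : 0 < geom ρ := pos_of_mul_pos_right (hh0.trans_lt hlt) hp.le
  have ha : geomPure ψ / p ≤ geom ρ := by
    rw [div_le_iff₀ hp, mul_comm]; exact hlt.le
  have hub : ∀ x ∈ achievableFidelities (ketbra ψ) ρ p,
      x ≤ Real.cos (Real.arcsin (√(geom ρ)) - Real.arcsin (√(geomPure ψ / p))) ^ 2 := by
    rintro _ ⟨Λ, hΛ, htr, rfl⟩
    obtain ⟨r, T, hT, hsum, hTi⟩ :=
      exists_purification_of_normalized_output hΛ hψ (hp.trans_le htr)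
    rw [fidelity_eq_rootFidelity_sq]
    refine pow_le_pow_left₀ (rootFidelity_nonneg _ _) (rootFidelity_le_cos hρ T hT hsum ?_ ha) 2
    rw [le_div_iff₀ hp, mul_comm]
    exact (mul_le_mul_of_nonneg_right htr (imagWeight_nonneg T)).trans hTi
  refine ⟨?_, hub⟩
  obtain ⟨Λ, hΛ, htr, hF⟩ := exists_realOperation_near hψ hρ hp hp1 (div_nonneg hh0 hp.le) ha hg0
    (mul_div_cancel₀ _ hp.ne')
  have hmem : fidelity (normalize (Λ (ketbra ψ))) ρ ∈ achievableFidelities (ketbra ψ) ρ p :=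
    ⟨Λ, hΛ, htr.ge, rfl⟩
  have hcos : 0 ≤ Real.cos (Real.arcsin (√(geom ρ)) - Real.arcsin (√(geomPure ψ / p))) :=
    Real.cos_nonneg_of_neg_pi_div_two_le_of_le
      (by linarith [Real.pi_pos, arcsin_sqrt_mono ha])
      (by linarith [Real.arcsin_le_pi_div_two (√(geom ρ)), arcsin_sqrt_nonneg (geomPure ψ / p)])
  convert! hmem using 1
  exact le_antisymm (pow_le_pow_left₀ hcos hF 2) (hub _ hmem)

/-- The optimal operation for `p = 1` in the fidelity problem already meets the fidelity
constraint. -/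
theorem isGreatest_achievableProbabilities_one {ψ : ι → ℂ} (hψ : IsPureState ψ)
    {ρ : Matrix κ κ ℂ} (hρ : IsDensityMatrix ρ) {f : ℝ} (hf : 0 ≤ f) (hf1 : f ≤ 1)
    (hm : 0 ≤ m₁ ψ ρ f) :
    IsGreatest (achievableProbabilities (ketbra ψ) ρ f) 1 := by
  have key : ∃ x ∈ achievableFidelities (ketbra ψ) ρ 1, f ≤ x := by
    rcases le_or_gt (geom ρ) (geomPure ψ) with h | h
    · exact ⟨1, (isGreatest_achievableFidelities_one hψ hρ one_pos le_rfl (by linarith)).1, hf1⟩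
    · refine ⟨_, (isGreatest_achievableFidelities_cos hψ hρ one_pos le_rfl (by linarith)).1, ?_⟩
      rw [div_one, ← Real.sq_sqrt hf]
      refine pow_le_pow_left₀ (Real.sqrt_nonneg f) ?_ 2
      rw [m₁] at hm
      rw [← Real.cos_arccos (x := √f) (by linarith [Real.sqrt_nonneg f]) (Real.sqrt_le_one.2 hf1)]
      exact Real.cos_le_cos_of_nonneg_of_le_pi (by linarith [arcsin_sqrt_mono h.le])
        (Real.arccos_le_pi _) (by linarith)
  obtain ⟨_, ⟨Λ, hΛ, htr, rfl⟩, hfx⟩ := key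
  constructor
  · exact ⟨Λ, hΛ, le_antisymm htr (trace_realOperation_le_one hΛ hψ), fun _ => hfx⟩
  · rintro _ ⟨Λ, hΛ, rfl, -⟩
    exact trace_realOperation_le_one hΛ hψ

theorem isGreatest_achievableProbabilities_div {ψ : ι → ℂ} (hψ : IsPureState ψ)
    {ρ : Matrix κ κ ℂ} (hρ : IsDensityMatrix ρ) {f : ℝ} (hf : 0 ≤ f) (hf1 : f ≤ 1)
    (hm : m₁ ψ ρ f < 0) :
    IsGreatest (achievableProbabilities (ketbra ψ) ρ f)
      (geomPure ψ / Real.sin (Real.arcsin (√(geom ρ)) - Real.arccos (√f)) ^ 2) := by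
  obtain ⟨-, -, -, -, -, hh2⟩ := exists_phase_geomPure_eq hψ
  obtain ⟨T₀, -, hT₀c, -, -, hg2⟩ := exists_optimal_purification hρ
  have hh0 := geomPure_nonneg hψ
  have hcosf : Real.cos (Real.arccos (√f)) = √f :=
    Real.cos_arccos (by linarith [Real.sqrt_nonneg f]) (Real.sqrt_le_one.2 hf1)
  rw [m₁] at hm
  set θ := Real.arcsin (√(geom ρ)) - Real.arccos (√f) with hθ
  set a := Real.sin θ ^ 2 with ha
  have hψ0 := arcsin_sqrt_nonneg (geomPure ψ)
  have hf0 := Real.arccos_nonneg (√f)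
  have hρ2 := Real.arcsin_le_pi_div_two (√(geom ρ))
  have hθ0 : 0 < θ := by linarith
  have hsin : 0 < Real.sin θ := Real.sin_pos_of_pos_of_lt_pi hθ0 (by linarith [Real.pi_pos])
  have ha0 : 0 < a := pow_pos hsin 2
  have hsqrt : √a = Real.sin θ := Real.sqrt_sq hsin.le
  have harc : Real.arcsin (√a) = θ := by
    rw [hsqrt, Real.arcsin_sin (by linarith) (by linarith)]
  have hha : geomPure ψ < a := by
    by_contra! h
    linarith [arcsin_sqrt_mono h]
  have hag : a ≤ geom ρ := by
    by_contra! h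
    have h1 : Real.arcsin (√(geom ρ)) < Real.arcsin (√a) :=
      Real.arcsin_lt_arcsin (by linarith [Real.sqrt_nonneg (geom ρ)])
        (Real.sqrt_lt_sqrt (geom_nonneg hρ) h) (by rw [hsqrt]; exact Real.sin_le_one θ)
    linarith
  constructor
  · rcases hh0.eq_or_lt with h0 | h0
    -- for `geomPure ψ = 0` the value is `0`, attained by the zero operation
    · rw [← h0, zero_div]
      obtain ⟨Λ, hΛ, hΛψ⟩ := exists_realOperation hψ T₀ hT₀c le_rfl (by linarith) (by linarith)
      exact ⟨Λ, hΛ, by rw [hΛψ]; simp, fun h => absurd rfl h⟩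
    · obtain ⟨Λ, hΛ, htr, hF⟩ := exists_realOperation_near hψ hρ (div_pos h0 ha0)
        ((div_le_one ha0).2 hha.le) ha0.le hag (ha0.trans_le hag) (div_mul_cancel₀ _ ha0.ne')
      refine ⟨Λ, hΛ, htr.symm, fun _ => ?_⟩
      rw [harc, hθ, sub_sub_cancel, hcosf] at hF
      rw [fidelity_eq_rootFidelity_sq, ← Real.sq_sqrt hf]
      exact pow_le_pow_left₀ (Real.sqrt_nonneg f) hF 2
  · rintro p ⟨Λ, hΛ, hp, hF⟩
    by_contra! hlt
    have hp0 : 0 < p := (div_nonneg hh0 ha0.le).trans_lt hlt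
    obtain ⟨r, T, hT, hsum, hTi⟩ :=
      exists_purification_of_normalized_output hΛ hψ (hp ▸ hp0)
    rw [← hp] at hTi
    have hb : geomPure ψ / p < a := by
      rw [div_lt_iff₀ ha0] at hlt
      rw [div_lt_iff₀ hp0]; linarith
    have h1 := rootFidelity_le_cos hρ T hT hsum (a := geomPure ψ / p)
      (by rw [le_div_iff₀ hp0, mul_comm]; exact hTi) (hb.le.trans hag)
    have h2 : Real.arcsin (√(geomPure ψ / p)) < θ := by
      rw [← harc]
      exact Real.arcsin_lt_arcsin (by linarith [Real.sqrt_nonneg (geomPure ψ / p)])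
        (Real.sqrt_lt_sqrt (div_nonneg hh0 hp0.le) hb) (by rw [hsqrt]; exact Real.sin_le_one θ)
    have h3 : Real.cos (Real.arcsin (√(geom ρ)) - Real.arcsin (√(geomPure ψ / p))) <
        Real.cos (Real.arccos (√f)) :=
      Real.cos_lt_cos_of_nonneg_of_le_pi hf0
        (by linarith [Real.pi_pos, arcsin_sqrt_nonneg (geomPure ψ / p)]) (by linarith)
    rw [hcosf] at h3
    have h4 := hF hp0.ne'
    rw [fidelity_eq_rootFidelity_sq] at h4
    exact absurd (h1.trans_lt h3) (not_lt.2 (Real.sqrt_le_iff.2 ⟨rootFidelity_nonneg _ _, h4⟩))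

end Optimality

end Imaginarity

theorem mainTheorem1 {ι κ : Type*} [Fintype ι] [Fintype κ] [DecidableEq κ]
    (ψ : ι → ℂ) (hψ : Imaginarity.IsPureState ψ)
    (ρ : Matrix κ κ ℂ) (hρ : Imaginarity.IsDensityMatrix ρ) :
    (∀ f : ℝ, 0 ≤ f → f ≤ 1 →
      IsGreatest (Imaginarity.achievableProbabilities (Imaginarity.ketbra ψ) ρ f)
        (Imaginarity.optimalProbability (Imaginarity.ketbra ψ) ρ f) ∧
      (0 ≤ Imaginarity.m₁ ψ ρ f →
        Imaginarity.optimalProbability (Imaginarity.ketbra ψ) ρ f = 1) ∧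
      (Imaginarity.m₁ ψ ρ f < 0 →
        Imaginarity.optimalProbability (Imaginarity.ketbra ψ) ρ f =
          Imaginarity.geomPure ψ /
            Real.sin (Real.arcsin (√(Imaginarity.geom ρ)) - Real.arccos (√f)) ^ 2)) ∧
    (∀ p : ℝ, 0 < p → p ≤ 1 →
      IsGreatest (Imaginarity.achievableFidelities (Imaginarity.ketbra ψ) ρ p)
        (Imaginarity.optimalFidelity (Imaginarity.ketbra ψ) ρ p) ∧
      (p * Imaginarity.geom ρ ≤ Imaginarity.geomPure ψ →
        Imaginarity.optimalFidelity (Imaginarity.ketbra ψ) ρ p = 1) ∧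
      (Imaginarity.geomPure ψ < p * Imaginarity.geom ρ →
        Imaginarity.optimalFidelity (Imaginarity.ketbra ψ) ρ p =
          Real.cos (Real.arcsin (√(Imaginarity.geom ρ)) -
            Real.arcsin (√(Imaginarity.geomPure ψ / p))) ^ 2)) := by
  refine ⟨fun f hf hf1 => ?_, fun p hp hp1 => ?_⟩
  · rcases le_or_gt 0 (Imaginarity.m₁ ψ ρ f) with hm | hm
    · have h := Imaginarity.isGreatest_achievableProbabilities_one hψ hρ hf hf1 hm
      have he : Imaginarity.optimalProbability (Imaginarity.ketbra ψ) ρ f = 1 := h.csSup_eq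
      exact ⟨he ▸ h, fun _ => he, fun hm' => absurd hm' hm.not_gt⟩
    · have h := Imaginarity.isGreatest_achievableProbabilities_div hψ hρ hf hf1 hm
      have he : Imaginarity.optimalProbability (Imaginarity.ketbra ψ) ρ f = _ := h.csSup_eq
      exact ⟨he ▸ h, fun hm' => absurd hm hm'.not_gt, fun _ => he⟩
  · rcases le_or_gt (p * Imaginarity.geom ρ) (Imaginarity.geomPure ψ) with hm | hm
    · have h := Imaginarity.isGreatest_achievableFidelities_one hψ hρ hp hp1 hm
      have he : Imaginarity.optimalFidelity (Imaginarity.ketbra ψ) ρ p = 1 := h.csSup_eq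
      exact ⟨he ▸ h, fun _ => he, fun hm' => absurd hm' hm.not_gt⟩
    · have h := Imaginarity.isGreatest_achievableFidelities_cos hψ hρ hp hp1 hm
      have he : Imaginarity.optimalFidelity (Imaginarity.ketbra ψ) ρ p = _ := h.csSup_eq
      exact ⟨he ▸ h, fun hm' => absurd hm hm'.not_gt, fun _ => he⟩
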